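/- Let $n\ge 3$ and let $\mathcal{DP}_n$ be the monoid of all partial isometries of $\{1,\dots,n\}$, that is, of all injective partial maps $\alpha$ from $\{1,\dots,n\}$ to itself such that $|i\alpha-j\alpha|=|i-j|$ for all $i,j\in\operatorname{Dom}(\alpha)$, under composition of partial maps, written from left to right. Consider the following $n+1$ distinct elements of $\mathcal{DP}_n$: for $1\le i\le n-2$, $x_i$ is the identity map restricted to $\{1,\dots,n\}\setminus\{n-i\}$; $x_{n-1}$ is the map $k\mapsto k+1$ with domain $\{1,\dots,n-1\}$; $x_n$ is the map $k\mapsto k-1$ with domain $\{2,\dots,n\}$; and $h$ is the permutation $k\mapsto n+1-k$. Let $B=\{x_1,\dots,x_n,h\}$, regarded also as an alphabet of $n+1$ letters, and let $U$ be the set of the following monoid relations over $B$: - $x_i^2=x_i$, for $1\le i\le\lfloor\frac{n-1}{2}\rfloor$; - $x_ix_j=x_jx_i$, for $1\le i<j\le n-2$; - $x_nx_{i+1}=x_ix_n$, for $1\le i\le n-3$; - $x_n^2hx_nh=hx_1hx_n$; - $hx_nhx_n^2=x_nx_1$; - $x_nhx_nhx_n=x_n$; - $x_n^n=x_1x_2\cdots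 x_{n-2}\,x_{n-1}x_{n-2}$; - $x_n^{n+1}=x_n^n$; - $h^2=1$; - $hx_n=x_{n-1}h$, and $hx_i=x_{n-i-1}h$ for $1\le i\le\lfloor\frac{n-1}{2}\rfloor$; - $x_n^{n-1}h=x_nx_{n-1}\cdots x_2x_1$. Then $\mathcal{DP}_n$ is defined by the presentation $\langle B\mid U\rangle$, on $n+1$ generators and $\frac12\left(n^2-n+13-(-1)^n\right)$ relations: the natural correspondence between letters and elements induces an isomorphism from $B^*/\rho_U$ onto $\mathcal{DP}_n$, where $B^*$ is the free monoid on $B$ and $\rho_U$ is the smallest congruence on $B^*$ containing $U$; and $|U|=\frac12\left(n^2-n+13-(-1)^n\right)$. -/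

import Mathlib

/-- The symmetric inverse monoid on `{1, …, n}`: all partial permutations of an `n`-element chain.
The point `k : Fin n` stands for `k + 1 ∈ {1, …, n}`. -/
def SymInvMonoid (n : ℕ) : Type := Fin n ≃. Fin n

/-- Maps act on the right: `α * β` is first `α`, then `β`. -/
instance (n : ℕ) : Monoid (SymInvMonoid n) where
  mul α β := PEquiv.trans α β
  one := PEquiv.refl (Fin n)
  mul_assoc α β γ := PEquiv.trans_assoc α β γ
  one_mul α := PEquiv.refl_trans α
  mul_one α := PEquiv.trans_refl α

/-- `α` is an isometry: `|iα - jα| = |i - j|` for all `i, j ∈ Dom α`. -/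
def IsPartialIsometry {n : ℕ} (α : Fin n ≃. Fin n) : Prop :=
  ∀ i j i' j' : Fin n, α i = some i' → α j = some j' →
    |((i' : ℕ) : ℤ) - ((j' : ℕ) : ℤ)| = |((i : ℕ) : ℤ) - ((j : ℕ) : ℤ)|

/-- The monoid of all partial isometries of `{1, …, n}`. -/
def DP (n : ℕ) : Submonoid (SymInvMonoid n) where
  carrier := {α | IsPartialIsometry α}
  one_mem' := by
    intro i j i' j' hi hj
    obtain rfl : i = i' := Option.some.inj hi
    obtain rfl : j = j' := Option.some.inj hj
    rfl
  mul_mem' := by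
    intro α β hα hβ i j i' j' hi hj
    obtain ⟨a, ha, ha'⟩ := (PEquiv.trans_eq_some α β i i').1 hi
    obtain ⟨b, hb, hb'⟩ := (PEquiv.trans_eq_some α β j j').1 hj
    rw [hβ a b i' j' ha' hb', hα i j a b ha hb]

/-- The partial identity of `{1, …, n}` whose domain omits exactly the point `p`. -/
def omitPoint (n p : ℕ) : Fin n ≃. Fin n :=
  PEquiv.ofSet {k : Fin n | (k : ℕ) + 1 ≠ p}

/-- The map `k ↦ k + 1` with domain `{1, …, n - 1}`. -/
def shiftUp (n : ℕ) : Fin n ≃. Fin n where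
  toFun k := if hk : (k : ℕ) + 1 < n then some ⟨(k : ℕ) + 1, hk⟩ else none
  invFun k := if (k : ℕ) = 0 then none else some ⟨(k : ℕ) - 1, by omega⟩
  inv a b := by
    by_cases hb : (b : ℕ) = 0 <;> by_cases ha : (a : ℕ) + 1 < n <;>
      simp [ha, hb, Fin.ext_iff] <;> omega

/-- The map `k ↦ k - 1` with domain `{2, …, n}`. -/
def shiftDown (n : ℕ) : Fin n ≃. Fin n := (shiftUp n).symm

/-- The reversal permutation `k ↦ n + 1 - k`. -/
def reversal (n : ℕ) : Fin n ≃. Fin n := Fin.revPerm.toPEquiv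

theorem shiftUp_eq_some {n : ℕ} {a b : Fin n} :
    shiftUp n a = some b ↔ (b : ℕ) = (a : ℕ) + 1 := by
  change (if hk : (a : ℕ) + 1 < n then some (⟨(a : ℕ) + 1, hk⟩ : Fin n) else none) = some b ↔ _
  by_cases ha : (a : ℕ) + 1 < n <;> simp [ha, Fin.ext_iff] <;> omega

theorem shiftDown_eq_some {n : ℕ} {a b : Fin n} :
    shiftDown n a = some b ↔ (a : ℕ) = (b : ℕ) + 1 := by
  rw [shiftDown, PEquiv.eq_some_iff, shiftUp_eq_some]

theorem omitPoint_isometry (n p : ℕ) : IsPartialIsometry (omitPoint n p) := by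
  intro i j i' j' hi hj
  obtain ⟨rfl, -⟩ := PEquiv.ofSet_eq_some_iff.1 hi
  obtain ⟨rfl, -⟩ := PEquiv.ofSet_eq_some_iff.1 hj
  rfl

theorem shiftUp_isometry (n : ℕ) : IsPartialIsometry (shiftUp n) := by
  intro i j i' j' hi hj
  rw [shiftUp_eq_some.1 hi, shiftUp_eq_some.1 hj]
  push_cast
  ring_nf

theorem shiftDown_isometry (n : ℕ) : IsPartialIsometry (shiftDown n) := by
  intro i j i' j' hi hj
  rw [shiftDown_eq_some.1 hi, shiftDown_eq_some.1 hj]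
  push_cast
  ring_nf

theorem reversal_isometry (n : ℕ) : IsPartialIsometry (reversal n) := by
  intro i j i' j' hi hj
  obtain rfl : Fin.rev i = i' := Option.some.inj hi
  obtain rfl : Fin.rev j = j' := Option.some.inj hj
  have h1 : (((Fin.rev i : Fin n) : ℕ) : ℤ) = n - 1 - (i : ℕ) := by
    rw [Fin.val_rev]; omega
  have h2 : (((Fin.rev j : Fin n) : ℕ) : ℤ) = n - 1 - (j : ℕ) := by
    rw [Fin.val_rev]; omega
  rw [h1, h2, abs_sub_comm]
  ring_nf

/-- The alphabet of letters `x_1, …, x_n, h`. -/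
inductive Letter (n : ℕ) : Type
  | x (i : ℕ) (hi : 1 ≤ i ∧ i ≤ n) : Letter n
  | h : Letter n

/-- The partial isometry named by a letter: `x_i` (for `1 ≤ i ≤ n - 2`) is the partial identity
omitting `n - i`, `x_{n-1}` is `k ↦ k + 1`, `x_n` is `k ↦ k - 1`, and `h` is the reversal. -/
def generator (n : ℕ) : Letter n → DP n
  | .x i _ =>
      if i = n then ⟨shiftDown n, shiftDown_isometry n⟩
      else if i = n - 1 then ⟨shiftUp n, shiftUp_isometry n⟩
      else ⟨omitPoint n (n - i), omitPoint_isometry n (n - i)⟩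
  | .h => ⟨reversal n, reversal_isometry n⟩

/-- The one-letter word `x_i`, for `1 ≤ i ≤ n`; only such indices occur in `relationsU` when
`3 ≤ n` (for other indices the value is the empty word). -/
def xw (n i : ℕ) : FreeMonoid (Letter n) :=
  if hi : 1 ≤ i ∧ i ≤ n then FreeMonoid.of (.x i hi) else 1

/-- The one-letter word `h`. -/
def hw (n : ℕ) : FreeMonoid (Letter n) := FreeMonoid.of .h

/-- The word `x_1 x_2 ⋯ x_m`. -/
def ascWord (n m : ℕ) : FreeMonoid (Letter n) :=
  ((List.range m).map fun k => xw n (k + 1)).prod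

/-- The word `x_m x_{m-1} ⋯ x_1`. -/
def descWord (n m : ℕ) : FreeMonoid (Letter n) :=
  ((List.range m).map fun k => xw n (m - k)).prod

/-- The set `U` of relations over the alphabet `x_1, …, x_n, h`; a pair `(u, v)` is the relation
`u = v`. Here `(n - 1) / 2` is rounded down. -/
def relationsU (n : ℕ) : Set (FreeMonoid (Letter n) × FreeMonoid (Letter n)) :=
  {r | ∃ i, 1 ≤ i ∧ i ≤ (n - 1) / 2 ∧ r = (xw n i ^ 2, xw n i)} ∪
  {r | ∃ i j, 1 ≤ i ∧ i < j ∧ j ≤ n - 2 ∧ r = (xw n i * xw n j, xw n j * xw n i)} ∪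
  {r | ∃ i, 1 ≤ i ∧ i ≤ n - 3 ∧ r = (xw n n * xw n (i + 1), xw n i * xw n n)} ∪
  {(xw n n ^ 2 * hw n * xw n n * hw n, hw n * xw n 1 * hw n * xw n n),
   (hw n * xw n n * hw n * xw n n ^ 2, xw n n * xw n 1),
   (xw n n * hw n * xw n n * hw n * xw n n, xw n n),
   (xw n n ^ n, ascWord n (n - 2) * xw n (n - 1) * xw n (n - 2)),
   (xw n n ^ (n + 1), xw n n ^ n),
   (hw n ^ 2, 1),
   (hw n * xw n n, xw n (n - 1) * hw n)} ∪
  {r | ∃ i, 1 ≤ i ∧ i ≤ (n - 1) / 2 ∧ r = (hw n * xw n i, xw n (n - i - 1) * hw n)} ∪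
  {(xw n n ^ (n - 1) * hw n, descWord n n)}

/-! The relations `U` hold for partial isometries, so the free monoid on the letters maps to `DP n`
through the presented monoid `M`. It remains to see that this map `φ : M → DP n` is bijective.

Write `s = x_n` and `t = h s h = x_{n-1}` for the two shifts, and `e p` for the idempotents omitting
one point: the inner ones are letters, and the outer ones are `e 0 = s t` and `e (n-1) = t s`.
In `M` the `e p` are commuting idempotents, `s (e p) = (e (p+1)) s`, dual rules hold for `t`, and `h`
exchanges `s` with `t` and `e p` with `e (n-1-p)`
(`isometryRelations_of_relationsU`). Moving the idempotents to the left and `h` to the right writes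
every element of `M` as `E s^d` or `E s^d h`, where `E` is a product of idempotents and `s^d` stands
for `t^{-d}` if `d < 0`. Since `e p` is absorbed by `s^d` whenever `p` is outside the domain of the
shift, `E` may be taken to be the product of the `e p` over all points `p` outside the domain of the
image in `DP n` (`eq_undefinedPoints_mul_shiftPow`), so `E` is determined by that image.

If the domain has at least two points, `d` and the presence of `h` can be read off from the image.
If it is empty, `E` is the product `z` of all the `e p`; the relations on `s^n` and `s^{n-1} h` give
`z s = z t = z h = z`, so the element is `z`. If it is a single point, the factor `h` can be replaced
by shifts (`exists_rankOne_mul_h`), and then `d` is read off from the image. This gives injectivity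
(`injective_of_generate`). Surjectivity holds because a partial isometry is a
restriction of a translation or a reflection (`exists_translation_or_reflection`).

The relations are counted family by family, the families being disjoint because they differ in the
lengths of their two sides or in the numbers of letters `h` and `x_n`
(`finite_and_ncard_relationsU`).
-/

/-! ### Products of commuting idempotents -/

section IdempotentProducts

variable {ι M : Type*} [Monoid M] {e : ι → M}

theorem mul_prod_map_eq_self {X : M} {L : List ι} (hX : ∀ p ∈ L, X * e p = X) :
    X * (L.map e).prod = X := by
  induction L with
  | nil => simp
  | cons p L ih =>
    rw [List.map_cons, List.prod_cons, ← mul_assoc, hX p (by simp),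
      ih fun q hq => hX q (by simp [hq])]

theorem prod_map_mul_eq_self {X : M} {L : List ι} (hX : ∀ p ∈ L, e p * X = X) :
    (L.map e).prod * X = X := by
  induction L with
  | nil => simp
  | cons p L ih =>
    rw [List.map_cons, List.prod_cons, mul_assoc, ih fun q hq => hX q (by simp [hq]),
      hX p (by simp)]

theorem prod_map_mul_of_mem (hc : ∀ p q, e p * e q = e q * e p) (hi : ∀ p, e p * e p = e p)
    {L : List ι} {p : ι} (hp : p ∈ L) : (L.map e).prod * e p = (L.map e).prod := by
  have hcomm : ∀ L : List ι, (L.map e).prod * e p = e p * (L.map e).prod := by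
    intro L
    induction L with
    | nil => simp
    | cons q L ih =>
      simp only [List.map_cons, List.prod_cons]
      rw [mul_assoc, ih, ← mul_assoc, hc, mul_assoc]
  induction L with
  | nil => simp at hp
  | cons q L ih =>
    simp only [List.map_cons, List.prod_cons]
    rcases List.mem_cons.1 hp with rfl | h
    · rw [mul_assoc, hcomm, ← mul_assoc, hi]
    · rw [mul_assoc, ih h]

theorem mul_prod_map_of_mem (hc : ∀ p q, e p * e q = e q * e p) (hi : ∀ p, e p * e p = e p)
    {L : List ι} {p : ι} (hp : p ∈ L) : e p * (L.map e).prod = (L.map e).prod := by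
  induction L with
  | nil => simp at hp
  | cons q L ih =>
    simp only [List.map_cons, List.prod_cons]
    rcases List.mem_cons.1 hp with rfl | h
    · rw [← mul_assoc, hi]
    · rw [← mul_assoc, hc, mul_assoc, ih h]

/-- A product of commuting idempotents only depends on the set of its factors. -/
theorem prod_map_congr (hc : ∀ p q, e p * e q = e q * e p) (hi : ∀ p, e p * e p = e p)
    {L L' : List ι} (h : ∀ p, p ∈ L ↔ p ∈ L') : (L.map e).prod = (L'.map e).prod := by
  rw [← mul_prod_map_eq_self fun p hp => prod_map_mul_of_mem hc hi ((h p).2 hp)]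
  exact prod_map_mul_eq_self fun p hp => mul_prod_map_of_mem hc hi ((h p).1 hp)

end IdempotentProducts

/-! ### Consequences of the relations in an abstract monoid -/

/-- Relations between elements `s`, `t`, `h` and `e p` of a monoid, satisfied by the two shifts
`k ↦ k - 1` and `k ↦ k + 1`, the reversal and the partial identities omitting one point `p`.
Points are numbered from `0`, as elements of `Fin n`. -/
structure IsometryRelations {n : ℕ} {M : Type*} [Monoid M] (s t h : M) (e : Fin n → M) :
    Prop where
  commute : ∀ p q, e p * e q = e q * e p
  idem : ∀ p, e p * e p = e p
  s_e : ∀ p q : Fin n, (q : ℕ) = p + 1 → s * e p = e q * s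
  s_last : ∀ p : Fin n, (p : ℕ) + 1 = n → s * e p = s
  first_s : ∀ p : Fin n, (p : ℕ) = 0 → e p * s = s
  first_eq : ∀ p : Fin n, (p : ℕ) = 0 → e p = s * t
  last_eq : ∀ p : Fin n, (p : ℕ) + 1 = n → e p = t * s
  h_h : h * h = 1
  h_s : h * s = t * h
  h_e : ∀ p, h * e p = e p.rev * h
  s_pow : s ^ n = ((List.finRange n).map e).prod * t
  s_pow_succ : s ^ (n + 1) = s ^ n
  s_pow_pred : ∀ L : List (Fin n), (∀ p, p ∈ L ↔ (p : ℕ) + 1 ≠ n) →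
    s ^ (n - 1) * h = (L.map e).prod

/-- The power `s ^ d` of `s` for an integer exponent `d`, with `t` in the role of `s⁻¹`. -/
def shiftPow {M : Type*} [Monoid M] (s t : M) (d : ℤ) : M := s ^ d.toNat * t ^ (-d).toNat

theorem shiftPow_natCast {M : Type*} [Monoid M] (s t : M) (k : ℕ) :
    shiftPow s t k = s ^ k := by
  simp [shiftPow]

theorem shiftPow_neg_natCast {M : Type*} [Monoid M] (s t : M) (k : ℕ) :
    shiftPow s t (-k) = t ^ k := by
  simp [shiftPow]

namespace IsometryRelations

variable {n : ℕ} {M : Type*} [Monoid M] {s t h : M} {e : Fin n → M}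
variable (H : IsometryRelations s t h e)
include H

theorem h_t : h * t = s * h := by
  have := congrArg (fun x => h * x * h) H.h_s
  simp only [← mul_assoc, H.h_h, one_mul] at this
  rw [this, mul_assoc, H.h_h, mul_one]

theorem h_mul_cancel {x y : M} (hxy : h * x = h * y) : x = y := by
  rw [← one_mul x, ← H.h_h, mul_assoc, hxy, ← mul_assoc, H.h_h, one_mul]

theorem t_e (p q : Fin n) (hq : (q : ℕ) = p + 1) : t * e q = e p * t := by
  apply H.h_mul_cancel
  rw [← mul_assoc, H.h_t, mul_assoc, H.h_e, ← mul_assoc, H.s_e q.rev p.rev, mul_assoc,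
    ← H.h_t, ← mul_assoc, ← H.h_e, mul_assoc]
  simp only [Fin.val_rev]
  omega

theorem t_first (p : Fin n) (hp : (p : ℕ) = 0) : t * e p = t := by
  apply H.h_mul_cancel
  rw [← mul_assoc, H.h_t, mul_assoc, H.h_e, ← mul_assoc, H.s_last]
  simp only [Fin.val_rev]
  omega

theorem last_t (p : Fin n) (hp : (p : ℕ) + 1 = n) : e p * t = t := by
  apply H.h_mul_cancel
  rw [← mul_assoc, H.h_e, mul_assoc, H.h_t, ← mul_assoc, H.first_s]
  simp only [Fin.val_rev]
  omega

theorem e_mul_s_pow (k : ℕ) (p : Fin n) (hp : (p : ℕ) < k) : e p * s ^ k = s ^ k := by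
  induction k generalizing p with
  | zero => omega
  | succ k ih =>
    rw [pow_succ', ← mul_assoc]
    by_cases h0 : (p : ℕ) = 0
    · rw [H.first_s p h0]
    · rw [← H.s_e ⟨p - 1, by omega⟩ p (by simp; omega), mul_assoc, ih _ (by simp; omega)]

theorem e_mul_t_pow (k : ℕ) (p : Fin n) (hp : n ≤ (p : ℕ) + k) : e p * t ^ k = t ^ k := by
  induction k generalizing p with
  | zero => omega
  | succ k ih =>
    rw [pow_succ', ← mul_assoc]
    by_cases h0 : (p : ℕ) + 1 = n
    · rw [H.last_t p h0]
    · rw [← H.t_e p ⟨p + 1, by omega⟩ (by simp), mul_assoc, ih _ (by simp; omega)]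

/-- A partial identity omitting a point outside the domain of a shift is absorbed by it. -/
theorem e_mul_shiftPow (d : ℤ) (p : Fin n) (hp : ∀ j : Fin n, (j : ℤ) ≠ p - d) :
    e p * shiftPow s t d = shiftPow s t d := by
  have hp' : (p : ℤ) - d < 0 ∨ n ≤ (p : ℤ) - d := by
    by_contra hcon
    push Not at hcon
    exact hp ⟨((p : ℤ) - d).toNat, by omega⟩ (by simp; omega)
  obtain ⟨k, rfl | rfl⟩ := d.eq_nat_or_neg
  · rw [shiftPow_natCast]
    exact H.e_mul_s_pow k p (by omega)
  · rw [shiftPow_neg_natCast]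
    exact H.e_mul_t_pow k p (by omega)

theorem s_mul_prod (L : List (Fin n)) : ∃ L' : List (Fin n),
    s * (L.map e).prod = (L'.map e).prod * s := by
  induction L with
  | nil => exact ⟨[], by simp⟩
  | cons p L ih =>
    obtain ⟨L', hL'⟩ := ih
    by_cases hp : (p : ℕ) + 1 = n
    · exact ⟨L', by rw [List.map_cons, List.prod_cons, ← mul_assoc, H.s_last p hp, hL']⟩
    · refine ⟨⟨p + 1, by omega⟩ :: L', ?_⟩
      rw [List.map_cons, List.prod_cons, ← mul_assoc, H.s_e p ⟨p + 1, by omega⟩ rfl, mul_assoc,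
        hL', List.map_cons, List.prod_cons, mul_assoc]

theorem t_mul_prod (L : List (Fin n)) : ∃ L' : List (Fin n),
    t * (L.map e).prod = (L'.map e).prod * t := by
  induction L with
  | nil => exact ⟨[], by simp⟩
  | cons p L ih =>
    obtain ⟨L', hL'⟩ := ih
    by_cases hp : (p : ℕ) = 0
    · exact ⟨L', by rw [List.map_cons, List.prod_cons, ← mul_assoc, H.t_first p hp, hL']⟩
    · refine ⟨⟨p - 1, by omega⟩ :: L', ?_⟩
      rw [List.map_cons, List.prod_cons, ← mul_assoc,
        H.t_e ⟨p - 1, by omega⟩ p (by simp; omega), mul_assoc,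
        hL', List.map_cons, List.prod_cons, mul_assoc]

/-- Up to a product of the idempotents `e p`, multiplication by `s` changes the exponent by one. -/
theorem s_mul_shiftPow (hn : 0 < n) (d : ℤ) : ∃ (L : List (Fin n)) (d' : ℤ),
    s * shiftPow s t d = (L.map e).prod * shiftPow s t d' := by
  obtain ⟨k, rfl | rfl⟩ := d.eq_nat_or_neg
  · exact ⟨[], ((k + 1 : ℕ) : ℤ), by
      rw [shiftPow_natCast, shiftPow_natCast, pow_succ']; simp⟩
  · cases k with
    | zero => exact ⟨[], ((1 : ℕ) : ℤ), by rw [shiftPow_natCast]; simp [shiftPow]⟩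
    | succ k =>
      refine ⟨[⟨0, hn⟩], -(k : ℤ), ?_⟩
      rw [shiftPow_neg_natCast, shiftPow_neg_natCast, pow_succ', ← mul_assoc,
        ← H.first_eq ⟨0, hn⟩ rfl]
      simp

theorem t_mul_shiftPow (hn : 0 < n) (d : ℤ) : ∃ (L : List (Fin n)) (d' : ℤ),
    t * shiftPow s t d = (L.map e).prod * shiftPow s t d' := by
  obtain ⟨k, rfl | rfl⟩ := d.eq_nat_or_neg
  · cases k with
    | zero => exact ⟨[], -((1 : ℕ) : ℤ), by rw [shiftPow_neg_natCast]; simp [shiftPow]⟩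
    | succ k =>
      refine ⟨[⟨n - 1, by omega⟩], (k : ℤ), ?_⟩
      rw [shiftPow_natCast, shiftPow_natCast, pow_succ', ← mul_assoc,
        ← H.last_eq ⟨n - 1, by omega⟩ (by simp; omega)]
      simp
  · exact ⟨[], -((k + 1 : ℕ) : ℤ), by
      rw [shiftPow_neg_natCast, shiftPow_neg_natCast, pow_succ']; simp⟩

/-- Normal form in the submonoid generated by the shifts and the idempotents. -/
theorem exists_eq_prod_mul_shiftPow (hn : 0 < n) {w : M}
    (hw : w ∈ Submonoid.closure (Set.range e ∪ {s, t})) :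
    ∃ (L : List (Fin n)) (d : ℤ), w = (L.map e).prod * shiftPow s t d := by
  induction hw using Submonoid.closure_induction_left with
  | one => exact ⟨[], 0, by simp [shiftPow]⟩
  | mul_left x hx y _ ih =>
    obtain ⟨L, d, rfl⟩ := ih
    rcases hx with ⟨p, rfl⟩ | rfl | rfl
    · exact ⟨p :: L, d, by rw [List.map_cons, List.prod_cons, mul_assoc]⟩
    · obtain ⟨L₁, h₁⟩ := H.s_mul_prod L
      obtain ⟨L₂, d', h₂⟩ := H.s_mul_shiftPow hn d
      exact ⟨L₁ ++ L₂, d', by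
        rw [← mul_assoc, h₁, mul_assoc, h₂, List.map_append, List.prod_append, mul_assoc]⟩
    · obtain ⟨L₁, h₁⟩ := H.t_mul_prod L
      obtain ⟨L₂, d', h₂⟩ := H.t_mul_shiftPow hn d
      exact ⟨L₁ ++ L₂, d', by
        rw [← mul_assoc, h₁, mul_assoc, h₂, List.map_append, List.prod_append, mul_assoc]⟩

/-- Conjugation by `h` preserves the submonoid generated by the shifts and the idempotents. -/
theorem conj_mem_closure {w : M} (hw : w ∈ Submonoid.closure (Set.range e ∪ {s, t})) :
    h * w * h ∈ Submonoid.closure (Set.range e ∪ {s, t}) := by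
  induction hw using Submonoid.closure_induction with
  | mem x hx =>
    apply Submonoid.subset_closure
    rcases hx with ⟨p, rfl⟩ | rfl | rfl
    · rw [H.h_e, mul_assoc, H.h_h, mul_one]
      exact Or.inl ⟨_, rfl⟩
    · rw [H.h_s, mul_assoc, H.h_h, mul_one]
      simp
    · rw [H.h_t, mul_assoc, H.h_h, mul_one]
      simp
  | one => rw [mul_one, H.h_h]; exact one_mem _
  | mul x y _ _ hx hy =>
    have : h * (x * y) * h = (h * x * h) * (h * y * h) := by
      simp only [mul_assoc]
      rw [← mul_assoc h h, H.h_h, one_mul]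
    rw [this]
    exact mul_mem hx hy

theorem exists_eq_or_eq_mul_h {w : M}
    (hw : w ∈ Submonoid.closure (Set.range e ∪ {s, t, h})) :
    ∃ o ∈ Submonoid.closure (Set.range e ∪ {s, t}), w = o ∨ w = o * h := by
  induction hw using Submonoid.closure_induction_left with
  | one => exact ⟨1, one_mem _, Or.inl rfl⟩
  | mul_left x hx y _ ih =>
    obtain ⟨o, ho, hy⟩ := ih
    have key : x ∈ Submonoid.closure (Set.range e ∪ {s, t}) ∨ x = h := by
      rcases hx with hx | rfl | rfl | rfl
      · exact Or.inl (Submonoid.subset_closure (Or.inl hx))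
      · exact Or.inl (Submonoid.subset_closure (by simp))
      · exact Or.inl (Submonoid.subset_closure (by simp))
      · exact Or.inr rfl
    rcases key with hx | rfl
    · refine ⟨x * o, mul_mem hx ho, ?_⟩
      rcases hy with rfl | rfl
      · exact Or.inl rfl
      · exact Or.inr (mul_assoc _ _ _).symm
    · refine ⟨x * o * x, H.conj_mem_closure ho, ?_⟩
      rcases hy with rfl | rfl
      · right
        rw [mul_assoc, H.h_h, mul_one]
      · left
        rw [mul_assoc]

/-! ### The zero and the elements of rank one -/

theorem zero_mul_e (p : Fin n) :
    ((List.finRange n).map e).prod * e p = ((List.finRange n).map e).prod :=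
  prod_map_mul_of_mem H.commute H.idem (List.mem_finRange p)

/-- The product of all the idempotents `e p`, which corresponds to the empty map, is a power of `s`. -/
theorem zero_eq_s_pow (hn : 0 < n) : s ^ n = ((List.finRange n).map e).prod := by
  rw [← H.s_pow_succ, pow_succ, H.s_pow, mul_assoc, ← H.last_eq ⟨n - 1, by omega⟩ (by simp; omega),
    H.zero_mul_e]

theorem zero_mul_t (hn : 0 < n) :
    ((List.finRange n).map e).prod * t = ((List.finRange n).map e).prod := by
  rw [← H.s_pow, H.zero_eq_s_pow hn]

theorem zero_mul_s (hn : 0 < n) :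
    ((List.finRange n).map e).prod * s = ((List.finRange n).map e).prod := by
  conv_lhs => rw [← H.zero_mul_t hn, mul_assoc,
    ← H.last_eq ⟨n - 1, by omega⟩ (by simp; omega), H.zero_mul_e]

/-- The relation for `s ^ (n - 1) * h`, multiplied by `s`, writes `s ^ n * h` as a product of `s` and
idempotents, all of which are absorbed. -/
theorem zero_mul_h (hn : 0 < n) :
    ((List.finRange n).map e).prod * h = ((List.finRange n).map e).prod := by
  set z := ((List.finRange n).map e).prod with hz
  have hL := H.s_pow_pred ((List.finRange n).filter fun p => (p : ℕ) + 1 ≠ n) (by simp)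
  have h1 : z * (s ^ n * h) = z := by
    obtain ⟨m, rfl⟩ : ∃ m, n = m + 1 := ⟨n - 1, by omega⟩
    rw [pow_succ', mul_assoc s, ← mul_assoc z s, H.zero_mul_s hn]
    rw [Nat.add_sub_cancel] at hL
    rw [hL]
    exact mul_prod_map_eq_self fun p _ => H.zero_mul_e p
  rw [H.zero_eq_s_pow hn, ← hz, ← mul_assoc] at h1
  rwa [mul_prod_map_eq_self fun p _ => H.zero_mul_e p] at h1

theorem zero_mul_shiftPow (hn : 0 < n) (d : ℤ) :
    ((List.finRange n).map e).prod * shiftPow s t d = ((List.finRange n).map e).prod := by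
  have hs : ∀ k : ℕ, ((List.finRange n).map e).prod * s ^ k = ((List.finRange n).map e).prod := by
    intro k
    induction k with
    | zero => simp
    | succ k ih => rw [pow_succ', ← mul_assoc, H.zero_mul_s hn, ih]
  have ht : ∀ k : ℕ, ((List.finRange n).map e).prod * t ^ k = ((List.finRange n).map e).prod := by
    intro k
    induction k with
    | zero => simp
    | succ k ih => rw [pow_succ', ← mul_assoc, H.zero_mul_t hn, ih]
  rw [shiftPow, ← mul_assoc, hs, ht]

/-- On an idempotent of rank one, the reversal `h` acts like a product of shifts. The relation
`s ^ (n - 1) * h = e 0 * ⋯ * e (n - 2)` gives this at the last point, and a conjugation by shifts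
carries it from each point to the preceding one. -/
theorem exists_rankOne_mul_h (k : ℕ) (a : Fin n) (ha : (a : ℕ) + k + 1 = n) (L : List (Fin n))
    (hL : ∀ p, p ∈ L ↔ p ≠ a) : ∃ o ∈ Submonoid.closure (Set.range e ∪ {s, t}),
      (L.map e).prod * h = (L.map e).prod * o := by
  induction k generalizing a L with
  | zero =>
    refine ⟨s ^ (n - 1), pow_mem (Submonoid.subset_closure (by simp)) _, ?_⟩
    rw [← H.s_pow_pred L, mul_assoc, H.h_h, mul_one]
    · rw [H.s_pow_pred L]
      · exact (prod_map_mul_eq_self fun p hp => H.e_mul_s_pow _ _ (by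
          have := (hL p).1 hp; rw [Ne, Fin.ext_iff] at this; omega)).symm
      · intro p; rw [hL, Ne, Fin.ext_iff]; omega
    · intro p; rw [hL, Ne, Fin.ext_iff]; omega
  | succ k ih =>
    obtain ⟨o, ho, hoh⟩ := ih ⟨a + 1, by omega⟩ (by simp; omega)
      ((List.finRange n).filter fun p => p ≠ ⟨a + 1, by omega⟩) (by simp)
    set L' := (List.finRange n).filter fun p => p ≠ ⟨a + 1, by omega⟩ with hL'
    have ht : t ∈ Submonoid.closure (Set.range e ∪ {s, t}) :=
      Submonoid.subset_closure (by simp)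
    refine ⟨t * o * t, mul_mem (mul_mem ht ho) ht, ?_⟩
    have h1 : (L.map e).prod * t * (L'.map e).prod = (L.map e).prod * t := by
      refine mul_prod_map_eq_self fun p hp => ?_
      rw [hL', List.mem_filter] at hp
      have hp' := hp.2
      simp only [ne_eq, Fin.ext_iff, decide_not, Bool.not_eq_eq_eq_not, Bool.not_true,
        decide_eq_false_iff_not] at hp'
      rw [mul_assoc]
      by_cases h0 : (p : ℕ) = 0
      · rw [H.t_first p h0]
      · rw [H.t_e ⟨p - 1, by omega⟩ p (by simp; omega), ← mul_assoc,
          prod_map_mul_of_mem H.commute H.idem]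
        rw [hL, Ne, Fin.ext_iff]
        simp
        omega
    have h2 : (L.map e).prod * (t * s) = (L.map e).prod := by
      rw [← H.last_eq ⟨n - 1, by omega⟩ (by simp; omega)]
      refine prod_map_mul_of_mem H.commute H.idem ?_
      rw [hL, Ne, Fin.ext_iff]
      simp
      omega
    calc (L.map e).prod * h = (L.map e).prod * (t * s) * h := by rw [h2]
      _ = (L.map e).prod * t * (h * t) := by rw [H.h_t]; simp only [mul_assoc]
      _ = (L.map e).prod * t * (L'.map e).prod * (h * t) := by rw [h1]
      _ = (L.map e).prod * t * ((L'.map e).prod * h) * t := by simp only [mul_assoc]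
      _ = (L.map e).prod * t * (L'.map e).prod * o * t := by rw [hoh]; simp only [mul_assoc]
      _ = (L.map e).prod * (t * o * t) := by rw [h1]; simp only [mul_assoc]

end IsometryRelations

/-! ### Graphs of partial isometries -/

namespace DP

variable {n : ℕ}

/-- `maps α i j` says that the partial isometry `α` is defined at `i` and sends `i` to `j`. -/
def maps (α : DP n) (i j : Fin n) : Prop := (show Fin n ≃. Fin n from α.1) i = some j

/-- The partial isometry `k ↦ k - 1`. -/
def down (n : ℕ) : DP n := ⟨shiftDown n, shiftDown_isometry n⟩

/-- The partial isometry `k ↦ k + 1`. -/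
def up (n : ℕ) : DP n := ⟨shiftUp n, shiftUp_isometry n⟩

/-- The partial identity omitting the point which is the `p`-th one, counted from `1`. -/
def omitting (n p : ℕ) : DP n := ⟨omitPoint n p, omitPoint_isometry n p⟩

/-- The reversal, as a partial isometry. -/
def rev (n : ℕ) : DP n := ⟨reversal n, reversal_isometry n⟩

theorem ext_maps {α β : DP n} (h : ∀ i j, maps α i j ↔ maps β i j) : α = β := by
  apply Subtype.ext
  exact PEquiv.ext fun i => Option.ext fun j => h i j

theorem maps_one (i j : Fin n) : maps (1 : DP n) i j ↔ (i : ℕ) = j := by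
  rw [← Fin.ext_iff]
  exact Option.some_inj

theorem maps_mul (α β : DP n) (i k : Fin n) :
    maps (α * β) i k ↔ ∃ j, maps α i j ∧ maps β j k :=
  PEquiv.trans_eq_some _ _ _ _

theorem maps_down (i j : Fin n) : maps (down n) i j ↔ (i : ℕ) = j + 1 := shiftDown_eq_some

theorem maps_up (i j : Fin n) : maps (up n) i j ↔ (j : ℕ) = i + 1 := shiftUp_eq_some

theorem maps_omitting (p : ℕ) (i j : Fin n) :
    maps (omitting n p) i j ↔ (i : ℕ) = j ∧ (i : ℕ) + 1 ≠ p := by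
  refine PEquiv.ofSet_eq_some_iff.trans ?_
  rw [Fin.ext_iff]
  change ((j : ℕ) = i ∧ (j : ℕ) + 1 ≠ p) ↔ _
  omega

theorem maps_rev (i j : Fin n) : maps (rev n) i j ↔ (i : ℕ) + j + 1 = n := by
  change some (Fin.rev i) = some j ↔ _
  rw [Option.some_inj, Fin.ext_iff, Fin.val_rev]
  omega

theorem maps_mul_down (α : DP n) (i k : Fin n) :
    maps (α * down n) i k ↔ ∃ hk : (k : ℕ) + 1 < n, maps α i ⟨k + 1, hk⟩ := by
  rw [maps_mul]
  constructor
  · rintro ⟨j, hj, hjk⟩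
    rw [maps_down] at hjk
    refine ⟨by omega, ?_⟩
    convert hj
    exact hjk.symm
  · rintro ⟨hk, h⟩
    exact ⟨_, h, (maps_down _ _).2 rfl⟩

theorem maps_mul_up (α : DP n) (i k : Fin n) :
    maps (α * up n) i k ↔ 0 < (k : ℕ) ∧ maps α i ⟨k - 1, by omega⟩ := by
  rw [maps_mul]
  constructor
  · rintro ⟨j, hj, hjk⟩
    rw [maps_up] at hjk
    refine ⟨by omega, ?_⟩
    convert hj
    omega
  · rintro ⟨hk, h⟩
    exact ⟨_, h, (maps_up _ _).2 (by simp; omega)⟩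

theorem maps_mul_omitting (p : ℕ) (α : DP n) (i k : Fin n) :
    maps (α * omitting n p) i k ↔ maps α i k ∧ (k : ℕ) + 1 ≠ p := by
  rw [maps_mul]
  constructor
  · rintro ⟨j, hj, hjk⟩
    rw [maps_omitting, ← Fin.ext_iff] at hjk
    obtain ⟨rfl, h⟩ := hjk
    exact ⟨hj, h⟩
  · rintro ⟨h, hk⟩
    exact ⟨k, h, (maps_omitting _ _ _).2 ⟨rfl, hk⟩⟩

theorem maps_mul_rev (α : DP n) (i k : Fin n) :
    maps (α * rev n) i k ↔ maps α i ⟨n - 1 - k, by omega⟩ := by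
  rw [maps_mul]
  constructor
  · rintro ⟨j, hj, hjk⟩
    rw [maps_rev] at hjk
    convert hj
    omega
  · intro h
    exact ⟨_, h, (maps_rev _ _).2 (by simp; omega)⟩

theorem maps_mul_down_pow (k : ℕ) (α : DP n) (i j : Fin n) :
    maps (α * down n ^ k) i j ↔ ∃ hk : (j : ℕ) + k < n, maps α i ⟨j + k, hk⟩ := by
  induction k generalizing j with
  | zero => simp
  | succ k ih =>
    rw [pow_succ, ← mul_assoc, maps_mul_down]
    constructor
    · rintro ⟨hj, h⟩
      obtain ⟨hk, h⟩ := (ih _).1 h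
      simp only at hk
      refine ⟨by omega, ?_⟩
      convert h using 2
      simp only
      omega
    · rintro ⟨hk, h⟩
      refine ⟨by omega, (ih _).2 ⟨by simp only; omega, ?_⟩⟩
      convert h using 2
      simp only
      omega

theorem maps_down_pow (k : ℕ) (i j : Fin n) :
    maps (down n ^ k) i j ↔ (i : ℕ) = j + k := by
  rw [← one_mul (down n ^ k), maps_mul_down_pow]
  simp only [maps_one, exists_prop]
  omega

theorem maps_up_pow (k : ℕ) (i j : Fin n) :
    maps (up n ^ k) i j ↔ (j : ℕ) = i + k := by
  induction k generalizing j with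
  | zero => simp [maps_one, eq_comm]
  | succ k ih =>
    rw [pow_succ, maps_mul_up, ih]
    simp only
    omega

theorem maps_shiftPow (d : ℤ) (i j : Fin n) :
    maps (shiftPow (down n) (up n) d) i j ↔ (j : ℤ) = i - d := by
  obtain ⟨k, rfl | rfl⟩ := d.eq_nat_or_neg
  · rw [shiftPow_natCast, maps_down_pow]
    omega
  · rw [shiftPow_neg_natCast, maps_up_pow]
    omega

theorem maps_prod_omitting (L : List ℕ) (i j : Fin n) :
    maps (L.map (omitting n)).prod i j ↔ (i : ℕ) = j ∧ (i : ℕ) + 1 ∉ L := by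
  induction L generalizing i with
  | nil => simp [maps_one]
  | cons p L ih =>
    rw [List.map_cons, List.prod_cons, maps_mul]
    constructor
    · rintro ⟨k, hk, h⟩
      rw [maps_omitting, ← Fin.ext_iff] at hk
      obtain ⟨rfl, hk⟩ := hk
      rw [ih] at h
      refine ⟨h.1, ?_⟩
      simp only [List.mem_cons, not_or]
      exact ⟨hk, h.2⟩
    · rintro ⟨hij, h⟩
      simp only [List.mem_cons, not_or] at h
      exact ⟨i, (maps_omitting _ _ _).2 ⟨rfl, h.1⟩, (ih i).2 ⟨hij, h.2⟩⟩

/-- Every partial isometry is a restriction of a translation or of a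
reflection: the image of one point leaves two candidates for the image of each further point, and a
second point which is not translated forces the reflection everywhere. -/
theorem exists_translation_or_reflection (α : DP n) :
    ∃ d : ℤ, (∀ i j, maps α i j → (j : ℤ) = i - d) ∨
      (∀ i j, maps α i j → (j : ℤ) = n - 1 - (i - d)) := by
  by_cases hα : ∃ a a', maps α a a'
  · obtain ⟨a, a', ha⟩ := hα
    by_cases hb : ∀ b b', maps α b b' → (b' : ℤ) = b - (a - a')
    · exact ⟨a - a', Or.inl hb⟩
    · push Not at hb
      obtain ⟨b, b', hb, hne⟩ := hb
      refine ⟨a + a' - (n - 1), Or.inr fun c c' hc => ?_⟩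
      have h1 := α.2 a b a' b' ha hb
      have h2 := α.2 a c a' c' ha hc
      have h3 := α.2 b c b' c' hb hc
      rw [abs_eq_abs] at h1 h2 h3
      omega
  · exact ⟨0, Or.inl fun i j hij => (hα ⟨i, j, hij⟩).elim⟩

end DP

/-! ### Normal forms and their graphs -/

/-- The list of the points outside the domain of a partial isometry. -/
noncomputable def undefinedPoints {n : ℕ} (α : DP n) : List (Fin n) :=
  open Classical in (List.finRange n).filter fun i => ¬ ∃ j, DP.maps α i j

theorem mem_undefinedPoints {n : ℕ} {α : DP n} {i : Fin n} :
    i ∈ undefinedPoints α ↔ ¬ ∃ j, DP.maps α i j := by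
  simp [undefinedPoints]

namespace IsometryRelations

open DP

variable {n : ℕ} {M : Type*} [Monoid M] {s t h : M} {e : Fin n → M} {φ : M →* DP n}

theorem map_shiftPow (hs : φ s = down n) (ht : φ t = up n) (d : ℤ) :
    φ (shiftPow s t d) = shiftPow (down n) (up n) d := by
  simp [shiftPow, hs, ht]

theorem maps_map_prod (he : ∀ p : Fin n, φ (e p) = omitting n (p + 1)) (L : List (Fin n))
    (i j : Fin n) : maps (φ (L.map e).prod) i j ↔ (i : ℕ) = j ∧ i ∉ L := by
  have h1 : φ (L.map e).prod = ((L.map fun p : Fin n => (p : ℕ) + 1).map (omitting n)).prod := by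
    rw [map_list_prod, List.map_map, List.map_map]
    congr 1
    exact List.map_congr_left fun p _ => he p
  rw [h1, maps_prod_omitting]
  simp [← Fin.ext_iff]

theorem maps_map_normalForm (hs : φ s = down n) (ht : φ t = up n)
    (he : ∀ p : Fin n, φ (e p) = omitting n (p + 1)) (L : List (Fin n)) (d : ℤ) (i j : Fin n) :
    maps (φ ((L.map e).prod * shiftPow s t d)) i j ↔ i ∉ L ∧ (j : ℤ) = i - d := by
  rw [map_mul, maps_mul]
  constructor
  · rintro ⟨k, hk, hkj⟩
    rw [maps_map_prod he, ← Fin.ext_iff] at hk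
    obtain ⟨rfl, hk⟩ := hk
    rw [map_shiftPow hs ht, maps_shiftPow] at hkj
    exact ⟨hk, hkj⟩
  · rintro ⟨hi, hij⟩
    refine ⟨i, (maps_map_prod he _ _ _).2 ⟨rfl, hi⟩, ?_⟩
    rw [map_shiftPow hs ht, maps_shiftPow]
    exact hij

theorem maps_map_normalForm_mul_h (hs : φ s = down n) (ht : φ t = up n) (hh : φ h = rev n)
    (he : ∀ p : Fin n, φ (e p) = omitting n (p + 1)) (L : List (Fin n)) (d : ℤ) (i j : Fin n) :
    maps (φ ((L.map e).prod * shiftPow s t d * h)) i j ↔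
      i ∉ L ∧ (j : ℤ) = n - 1 - (i - d) := by
  rw [map_mul, hh, maps_mul_rev, maps_map_normalForm hs ht he]
  refine and_congr_right fun _ => ?_
  simp only
  omega

theorem undefinedPoints_mul_h (hh : φ h = rev n) (w : M) (i : Fin n) :
    i ∈ undefinedPoints (φ (w * h)) ↔ i ∈ undefinedPoints (φ w) := by
  rw [mem_undefinedPoints, mem_undefinedPoints, map_mul, hh, not_iff_not]
  constructor
  · rintro ⟨j, hj⟩
    exact ⟨_, (maps_mul_rev _ _ _).1 hj⟩
  · rintro ⟨j, hj⟩
    refine ⟨⟨n - 1 - j, by omega⟩, (maps_mul_rev _ _ _).2 ?_⟩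
    convert hj
    simp only
    omega

variable (H : IsometryRelations s t h e)
include H

/-- In the normal form of an element of the submonoid generated by the shifts and the idempotents,
the idempotent part can be taken to be the partial identity on the domain of the image. -/
theorem eq_undefinedPoints_mul_shiftPow (hn : 0 < n) (hs : φ s = down n) (ht : φ t = up n)
    (he : ∀ p : Fin n, φ (e p) = omitting n (p + 1)) {w : M}
    (hw : w ∈ Submonoid.closure (Set.range e ∪ {s, t})) :
    ∃ d : ℤ, w = ((undefinedPoints (φ w)).map e).prod * shiftPow s t d := by
  obtain ⟨L, d, rfl⟩ := H.exists_eq_prod_mul_shiftPow hn hw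
  refine ⟨d, ?_⟩
  have h1 : ((undefinedPoints (shiftPow (down n) (up n) d)).map e).prod * shiftPow s t d =
      shiftPow s t d := by
    refine prod_map_mul_eq_self fun p hp => H.e_mul_shiftPow d p fun j hj => ?_
    exact mem_undefinedPoints.1 hp ⟨j, (maps_shiftPow _ _ _).2 hj⟩
  nth_rw 1 [← h1]
  rw [← mul_assoc, ← List.prod_append, ← List.map_append]
  congr 1
  refine prod_map_congr H.commute H.idem fun p => ?_
  rw [List.mem_append, mem_undefinedPoints, mem_undefinedPoints]
  simp only [maps_map_normalForm hs ht he, maps_shiftPow]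
  by_cases hp : p ∈ L <;> simp [hp]

/-- Every element has a normal form in which the idempotent part is the partial identity on the
domain of the image, and in which the reversal occurs only if that domain has two points. -/
theorem exists_normalForm (hn : 0 < n) (hs : φ s = down n) (ht : φ t = up n) (hh : φ h = rev n)
    (he : ∀ p : Fin n, φ (e p) = omitting n (p + 1)) {w : M}
    (hw : w ∈ Submonoid.closure (Set.range e ∪ {s, t, h})) :
    ∃ d : ℤ, w = ((undefinedPoints (φ w)).map e).prod * shiftPow s t d ∨
      (w = ((undefinedPoints (φ w)).map e).prod * shiftPow s t d * h ∧
        ∃ a b, a ≠ b ∧ a ∉ undefinedPoints (φ w) ∧ b ∉ undefinedPoints (φ w)) := by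
  obtain ⟨o, ho, rfl | rfl⟩ := H.exists_eq_or_eq_mul_h hw
  · obtain ⟨d, hd⟩ := H.eq_undefinedPoints_mul_shiftPow hn hs ht he ho
    exact ⟨d, Or.inl hd⟩
  obtain ⟨d, hd⟩ := H.eq_undefinedPoints_mul_shiftPow hn hs ht he ho
  rw [← prod_map_congr H.commute H.idem (undefinedPoints_mul_h hh o)] at hd
  by_cases h2 : ∃ a b, a ≠ b ∧ a ∉ undefinedPoints (φ (o * h)) ∧ b ∉ undefinedPoints (φ (o * h))
  · exact ⟨d, Or.inr ⟨by rw [← hd], h2⟩⟩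
  push Not at h2
  by_cases h1 : ∃ a, a ∉ undefinedPoints (φ (o * h))
  · obtain ⟨a, ha⟩ := h1
    obtain ⟨o', ho', hoo⟩ := H.exists_rankOne_mul_h (n - 1 - a) a (by omega)
      (undefinedPoints (φ (o * h))) fun p => ⟨fun hp hpa => ha (hpa ▸ hp), fun hp => by
        by_contra hcon
        exact h2 p a hp hcon |> ha⟩
    have hg : shiftPow s t d ∈ Submonoid.closure (Set.range e ∪ {s, t}) :=
      mul_mem (pow_mem (Submonoid.subset_closure (by simp)) _)
        (pow_mem (Submonoid.subset_closure (by simp)) _)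
    have hmem : o * h ∈ Submonoid.closure (Set.range e ∪ {s, t}) := by
      have h3 : o * h = ((undefinedPoints (φ (o * h))).map e).prod * o' *
          (h * shiftPow s t d * h) := by
        rw [← hoo]
        nth_rw 1 [hd]
        simp only [← mul_assoc]
        rw [mul_assoc _ h h, H.h_h, mul_one]
      rw [h3]
      refine mul_mem (mul_mem (list_prod_mem ?_) ho') (H.conj_mem_closure hg)
      intro x hx
      obtain ⟨p, -, rfl⟩ := List.mem_map.1 hx
      exact Submonoid.subset_closure (Or.inl ⟨p, rfl⟩)
    obtain ⟨d', hd'⟩ := H.eq_undefinedPoints_mul_shiftPow hn hs ht he hmem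
    exact ⟨d', Or.inl hd'⟩
  · push Not at h1
    refine ⟨d, Or.inl ?_⟩
    have hz := prod_map_congr H.commute H.idem
      fun p => iff_of_true (h1 p) (List.mem_finRange p)
    nth_rw 1 [hd]
    rw [hz, H.zero_mul_shiftPow hn, H.zero_mul_h hn]

/-- Two elements with the same image have normal forms with the same idempotent part; on a nonempty
domain the image also determines the shift and the factor `h`, and on an empty one both are absorbed. -/
theorem injective_of_generate (hn : 0 < n) (hs : φ s = down n) (ht : φ t = up n)
    (hh : φ h = rev n) (he : ∀ p : Fin n, φ (e p) = omitting n (p + 1))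
    (hgen : Submonoid.closure (Set.range e ∪ {s, t, h}) = ⊤) : Function.Injective φ := by
  intro w w' hww
  obtain ⟨d, hd⟩ := H.exists_normalForm hn hs ht hh he (hgen ▸ Submonoid.mem_top w)
  obtain ⟨d', hd'⟩ := H.exists_normalForm hn hs ht hh he (hgen ▸ Submonoid.mem_top w')
  rw [← hww] at hd'
  set C := undefinedPoints (φ w) with hC
  by_cases h1 : ∃ a, a ∉ C
  · obtain ⟨a, ha⟩ := h1
    obtain ⟨a', haa⟩ : ∃ a', maps (φ w) a a' := by
      by_contra hcon
      exact ha (mem_undefinedPoints.2 hcon)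
    have haa' := haa
    rw [hww] at haa'
    rcases hd with hd | ⟨hd, b, c, hbc, hb, hc⟩ <;>
      rcases hd' with hd' | ⟨hd', b', c', hbc', hb', hc'⟩
    · rw [hd, maps_map_normalForm hs ht he] at haa
      rw [hd', maps_map_normalForm hs ht he] at haa'
      obtain rfl : d = d' := by omega
      rw [hd, hd']
    · exfalso
      have key : ∀ b, b ∉ C → (b : ℤ) - d = n - 1 - (b - d') := by
        intro b hb
        obtain ⟨x, hx⟩ : ∃ x, maps (φ w) b x := by
          by_contra hcon
          exact hb (mem_undefinedPoints.2 hcon)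
        have hx' := hx
        rw [hww, hd', maps_map_normalForm_mul_h hs ht hh he] at hx'
        rw [hd, maps_map_normalForm hs ht he] at hx
        omega
      have h3 := key b' hb'
      have h4 := key c' hc'
      rw [Ne, Fin.ext_iff] at hbc'
      omega
    · exfalso
      have key : ∀ b, b ∉ C → (b : ℤ) - d' = n - 1 - (b - d) := by
        intro b hb
        obtain ⟨x, hx⟩ : ∃ x, maps (φ w) b x := by
          by_contra hcon
          exact hb (mem_undefinedPoints.2 hcon)
        have hx' := hx
        rw [hww, hd', maps_map_normalForm hs ht he] at hx'
        rw [hd, maps_map_normalForm_mul_h hs ht hh he] at hx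
        omega
      have h3 := key b hb
      have h4 := key c hc
      rw [Ne, Fin.ext_iff] at hbc
      omega
    · rw [hd, maps_map_normalForm_mul_h hs ht hh he] at haa
      rw [hd', maps_map_normalForm_mul_h hs ht hh he] at haa'
      obtain rfl : d = d' := by omega
      rw [hd, hd']
  · push Not at h1
    have hz := prod_map_congr H.commute H.idem
      fun p => iff_of_true (h1 p) (List.mem_finRange p)
    have key : ∀ (w : M) (d : ℤ), (w = (C.map e).prod * shiftPow s t d ∨
        (w = (C.map e).prod * shiftPow s t d * h ∧ ∃ a b, a ≠ b ∧ a ∉ C ∧ b ∉ C)) →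
        w = ((List.finRange n).map e).prod := by
      rintro w d (hd | ⟨hd, -⟩)
      · rw [hd, hz, H.zero_mul_shiftPow hn]
      · rw [hd, hz, H.zero_mul_shiftPow hn, H.zero_mul_h hn]
    rw [key w d hd, key w' d' hd']

omit H in
theorem surjective_of_map_eq (hs : φ s = down n) (ht : φ t = up n)
    (hh : φ h = rev n) (he : ∀ p : Fin n, φ (e p) = omitting n (p + 1)) : Function.Surjective φ := by
  intro α
  have hdom : ∀ i, i ∉ undefinedPoints α ↔ ∃ j, maps α i j := fun i => by
    rw [mem_undefinedPoints, not_not]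
  obtain ⟨d, hd | hd⟩ := exists_translation_or_reflection α
  · refine ⟨((undefinedPoints α).map e).prod * shiftPow s t d, ext_maps fun i j => ?_⟩
    rw [maps_map_normalForm hs ht he, hdom]
    constructor
    · rintro ⟨⟨k, hk⟩, hij⟩
      obtain rfl : j = k := Fin.ext (by have := hd i k hk; omega)
      exact hk
    · exact fun hij => ⟨⟨j, hij⟩, hd i j hij⟩
  · refine ⟨((undefinedPoints α).map e).prod * shiftPow s t d * h, ext_maps fun i j => ?_⟩
    rw [maps_map_normalForm_mul_h hs ht hh he, hdom]
    constructor
    · rintro ⟨⟨k, hk⟩, hij⟩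
      obtain rfl : j = k := Fin.ext (by have := hd i k hk; omega)
      exact hk
    · exact fun hij => ⟨⟨j, hij⟩, hd i j hij⟩

end IsometryRelations

/-! ### The defining relations in an arbitrary monoid -/

/-- The element playing the role of the partial identity omitting the point `p`, counted from `0`:
for an inner point it is a generator, and for the two end points a product of two shifts. -/
def pointIdempotent {M : Type*} [Monoid M] (n : ℕ) (x : ℕ → M) (p : Fin n) : M :=
  if (p : ℕ) = 0 then x n * x (n - 1)
  else if (p : ℕ) + 1 = n then x (n - 1) * x n else x (n - 1 - p)

theorem pointIdempotent_inner {M : Type*} [Monoid M] {n : ℕ} (x : ℕ → M) (i : ℕ) (p : Fin n)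
    (hi : 1 ≤ i) (hin : i ≤ n - 2) (hp : (p : ℕ) + i + 1 = n) : pointIdempotent n x p = x i := by
  rw [pointIdempotent, if_neg (by omega), if_neg (by omega)]
  congr 1
  omega

theorem range_eq_cons_cons {n : ℕ} (hn : 2 ≤ n) :
    List.range n = 0 :: 1 :: (List.range (n - 2)).map (· + 2) := by
  obtain ⟨m, rfl⟩ : ∃ m, n = m + 2 := ⟨n - 2, by omega⟩
  rw [List.range_succ_eq_map, List.range_succ_eq_map]
  simp

section Presentation

variable {n : ℕ} {M : Type*} [Monoid M] {π : FreeMonoid (Letter n) →* M}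

/-- The relations `U` imply all the relations collected in `IsometryRelations`. Half of the
relations between shifts and idempotents follow from the other half by conjugation by `h`. -/
theorem isometryRelations_of_relationsU (hn : 3 ≤ n)
    (hπ : ∀ u v, (u, v) ∈ relationsU n → π u = π v) :
    IsometryRelations (π (xw n n)) (π (xw n (n - 1))) (π (hw n))
      (pointIdempotent n fun i => π (xw n i)) := by
  -- the names `r1`, …, `r12` follow the order in which `relationsU` lists the relations
  have r1 : ∀ i, 1 ≤ i → i ≤ (n - 1) / 2 → π (xw n i) * π (xw n i) = π (xw n i) := by
    intro i h1 h2
    have := hπ (xw n i ^ 2) (xw n i) (by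
      iterate 5 left
      exact ⟨i, h1, h2, rfl⟩)
    rwa [pow_two, map_mul] at this
  have r2 : ∀ i j, 1 ≤ i → i < j → j ≤ n - 2 →
      π (xw n i) * π (xw n j) = π (xw n j) * π (xw n i) := by
    intro i j h1 h2 h3
    have := hπ (xw n i * xw n j) (xw n j * xw n i) (by
      iterate 4 left
      right
      exact ⟨i, j, h1, h2, h3, rfl⟩)
    rwa [map_mul, map_mul] at this
  have r3 : ∀ i, 1 ≤ i → i ≤ n - 3 →
      π (xw n n) * π (xw n (i + 1)) = π (xw n i) * π (xw n n) := by
    intro i h1 h2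
    have := hπ (xw n n * xw n (i + 1)) (xw n i * xw n n) (by
      iterate 3 left
      right
      exact ⟨i, h1, h2, rfl⟩)
    rwa [map_mul, map_mul] at this
  have r11 : ∀ i, 1 ≤ i → i ≤ (n - 1) / 2 →
      π (hw n) * π (xw n i) = π (xw n (n - i - 1)) * π (hw n) := by
    intro i h1 h2
    have := hπ (hw n * xw n i) (xw n (n - i - 1) * hw n) (by
      left; right
      exact ⟨i, h1, h2, rfl⟩)
    rwa [map_mul, map_mul] at this
  have r4 := hπ (xw n n ^ 2 * hw n * xw n n * hw n) (hw n * xw n 1 * hw n * xw n n)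
    (by left; left; right; simp)
  have r5 := hπ (hw n * xw n n * hw n * xw n n ^ 2) (xw n n * xw n 1)
    (by left; left; right; simp)
  have r6 := hπ (xw n n * hw n * xw n n * hw n * xw n n) (xw n n)
    (by left; left; right; simp)
  have r7 := hπ (xw n n ^ n) (ascWord n (n - 2) * xw n (n - 1) * xw n (n - 2))
    (by left; left; right; simp)
  have r8 := hπ (xw n n ^ (n + 1)) (xw n n ^ n) (by left; left; right; simp)
  have r9 := hπ (hw n ^ 2) 1 (by left; left; right; simp)
  have r10 := hπ (hw n * xw n n) (xw n (n - 1) * hw n) (by left; left; right; simp)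
  have r12 := hπ (xw n n ^ (n - 1) * hw n) (descWord n n) (by right; rfl)
  rw [ascWord] at r7
  rw [descWord] at r12
  simp only [map_mul, map_pow, map_one, map_list_prod, List.map_map, pow_two]
    at r4 r5 r6 r7 r8 r9 r10 r12
  set x : ℕ → M := fun i => π (xw n i) with hx
  have hxi : ∀ i, π (xw n i) = x i := fun i => rfl
  simp only [hxi] at r1 r2 r3 r4 r5 r6 r7 r8 r10 r11 r12 ⊢
  set s := x n
  set t := x (n - 1)
  set h := π (hw n)
  set e := pointIdempotent n x with he
  have hcan : ∀ y : M, h * (h * y) = y := fun y => by rw [← mul_assoc, r9, one_mul]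
  have hcan' : ∀ y : M, y * h * h = y := fun y => by rw [mul_assoc, r9, mul_one]
  have hinj : ∀ {y z : M}, h * y = h * z → y = z := fun {y z} hyz => by
    rw [← hcan y, hyz, hcan]
  have ht : h * t = s * h := by
    rw [← hcan' t, ← r10, ← mul_assoc, hcan]
  -- the reversal exchanges the inner points symmetrically
  have hxall : ∀ i, 1 ≤ i → i ≤ n - 2 → h * x i = x (n - 1 - i) * h := by
    intro i h1 h2
    by_cases h3 : i ≤ (n - 1) / 2
    · rw [r11 i h1 h3]
      congr 2
      omega
    · have := r11 (n - 1 - i) (by omega) (by omega)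
      rw [show n - (n - 1 - i) - 1 = i by omega] at this
      rw [← hcan' (x i), ← this, ← mul_assoc, hcan]
  have e_first : ∀ p : Fin n, (p : ℕ) = 0 → e p = s * t := fun p hp => if_pos hp
  have e_last : ∀ p : Fin n, (p : ℕ) + 1 = n → e p = t * s := fun p hp => by
    rw [he, pointIdempotent, if_neg (by omega), if_pos hp]
  have e_inner : ∀ (i : ℕ) (p : Fin n), 1 ≤ i → i ≤ n - 2 → (p : ℕ) + i + 1 = n → e p = x i :=
    fun i p h1 h2 h3 => pointIdempotent_inner x i p h1 h2 h3
  have h_e : ∀ p, h * e p = e p.rev * h := by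
    intro p
    by_cases h0 : (p : ℕ) = 0
    · rw [e_first p h0, e_last p.rev (by rw [Fin.val_rev]; omega), ← mul_assoc, r10, mul_assoc, ht,
        mul_assoc]
    by_cases h1 : (p : ℕ) + 1 = n
    · rw [e_last p h1, e_first p.rev (by rw [Fin.val_rev]; omega), ← mul_assoc, ht, mul_assoc, r10,
        mul_assoc]
    · rw [e_inner (n - 1 - p) p (by omega) (by omega) (by omega),
        e_inner p p.rev (by omega) (by omega) (by rw [Fin.val_rev]; omega),
        hxall _ (by omega) (by omega)]
      congr 2
      omega
  have hsh : h * s * h = t := by rw [r10, hcan']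
  have sts : s * t * s = s := by
    rw [← hsh]
    simpa only [mul_assoc] using r6
  have tst : t * s * t = t := by
    apply hinj
    rw [← mul_assoc, ← mul_assoc, ht, mul_assoc s, r10, ← mul_assoc, mul_assoc _ h, ht, ← mul_assoc,
      sts]
  have s_e : ∀ p q : Fin n, (q : ℕ) = p + 1 → s * e p = e q * s := by
    intro p q hq
    by_cases h0 : (p : ℕ) = 0
    · rw [e_first p h0, e_inner (n - 2) q (by omega) (by omega) (by omega), ← hsh]
      have h1 : h * x 1 * h = x (n - 2) := by
        rw [hxall 1 (by omega) (by omega), hcan']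
        congr 1
      rw [← h1, ← r4]
      simp only [mul_assoc]
    by_cases h1 : (q : ℕ) + 1 = n
    · rw [e_last q h1, e_inner 1 p le_rfl (by omega) (by omega), ← r5, ← hsh]
      simp only [mul_assoc]
    · rw [e_inner (n - 1 - q + 1) p (by omega) (by omega) (by omega),
        e_inner (n - 1 - q) q (by omega) (by omega) (by omega), r3 _ (by omega) (by omega)]
  have t_e : ∀ p q : Fin n, (q : ℕ) = p + 1 → t * e q = e p * t := by
    intro p q hq
    apply hinj
    rw [← mul_assoc, ht, mul_assoc, h_e, ← mul_assoc, s_e q.rev p.rev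
      (by simp only [Fin.val_rev]; omega), mul_assoc, ← ht, ← mul_assoc, ← h_e, mul_assoc]
  have comm0 : ∀ p q : Fin n, (p : ℕ) = 0 → e p * e q = e q * e p := by
    intro p q hp
    by_cases hq : (q : ℕ) = 0
    · rw [Fin.ext (hp.trans hq.symm)]
    · rw [e_first p hp, mul_assoc, t_e ⟨q - 1, by omega⟩ q (by simp; omega), ← mul_assoc,
        s_e _ q (by simp; omega), mul_assoc]
  have comm1 : ∀ p q : Fin n, (p : ℕ) + 1 = n → e p * e q = e q * e p := by
    intro p q hp
    apply hinj
    rw [← mul_assoc, ← mul_assoc, h_e, h_e, mul_assoc, mul_assoc, h_e, h_e, ← mul_assoc,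
      ← mul_assoc, comm0 _ _ (by rw [Fin.val_rev]; omega)]
  have idem0 : ∀ p : Fin n, (p : ℕ) = 0 → e p * e p = e p := by
    intro p hp
    rw [e_first p hp, ← mul_assoc, sts]
  have commute : ∀ p q, e p * e q = e q * e p := by
    intro p q
    by_cases p0 : (p : ℕ) = 0
    · exact comm0 p q p0
    by_cases p1 : (p : ℕ) + 1 = n
    · exact comm1 p q p1
    by_cases q0 : (q : ℕ) = 0
    · exact (comm0 q p q0).symm
    by_cases q1 : (q : ℕ) + 1 = n
    · exact (comm1 q p q1).symm
    rw [e_inner (n - 1 - p) p (by omega) (by omega) (by omega),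
      e_inner (n - 1 - q) q (by omega) (by omega) (by omega)]
    rcases lt_trichotomy (n - 1 - (p : ℕ)) (n - 1 - q) with hpq | hpq | hpq
    · exact r2 _ _ (by omega) hpq (by omega)
    · rw [hpq]
    · exact (r2 _ _ (by omega) hpq (by omega)).symm
  have idem : ∀ p, e p * e p = e p := by
    intro p
    -- one of the points `p` and `p.rev` lies in the half covered by the relations `x i ^ 2 = x i`
    have hrev : e p.rev * e p.rev = e p.rev → e p * e p = e p := fun hp => by
      apply hinj
      rw [← mul_assoc, h_e, mul_assoc, h_e, ← mul_assoc, hp]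
    by_cases p0 : (p : ℕ) = 0
    · exact idem0 p p0
    by_cases p1 : (p : ℕ) + 1 = n
    · exact hrev (idem0 _ (by rw [Fin.val_rev]; omega))
    by_cases p2 : n - 1 - p ≤ (n - 1) / 2
    · rw [e_inner (n - 1 - p) p (by omega) (by omega) (by omega)]
      exact r1 _ (by omega) p2
    · refine hrev ?_
      rw [e_inner p p.rev (by omega) (by omega) (by rw [Fin.val_rev]; omega)]
      exact r1 _ (by omega) (by omega)
  refine ⟨commute, idem, s_e, ?_, ?_, e_first, e_last, r9, r10, h_e, ?_, r8, ?_⟩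
  · intro p hp
    rw [e_last p hp, ← mul_assoc, sts]
  · intro p hp
    rw [e_first p hp, sts]
  · set L : List (Fin n) := (List.range (n - 2)).map fun k => ⟨n - 2 - k, by omega⟩ with hL
    have hasc : ((List.range (n - 2)).map (π ∘ fun k => xw n (k + 1))).prod = (L.map e).prod := by
      rw [hL, List.map_map]
      congr 1
      refine List.map_congr_left fun k hk => ?_
      rw [List.mem_range] at hk
      exact (e_inner (k + 1) _ (by omega) (by omega) (by simp only; omega)).symm
    rw [r7, hasc, ← e_inner (n - 2) ⟨1, by omega⟩ (by omega) (by omega) (by simp only; omega),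
      mul_assoc, t_e ⟨0, by omega⟩ ⟨1, by omega⟩ rfl]
    have hlast : e ⟨n - 1, by omega⟩ * t = t := by
      rw [e_last _ (by simp only; omega), tst]
    conv_lhs => rw [← hlast]
    have := prod_map_congr commute idem
      (L := L ++ [⟨0, by omega⟩, ⟨n - 1, by omega⟩]) (L' := List.finRange n) (by
        intro p
        simp only [hL, List.mem_append, List.mem_map, List.mem_range, List.mem_cons,
          List.mem_finRange, Fin.ext_iff, List.not_mem_nil, or_false, iff_true]
        by_cases p0 : (p : ℕ) = 0
        · exact Or.inr (Or.inl p0)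
        by_cases p1 : (p : ℕ) = n - 1
        · exact Or.inr (Or.inr p1)
        · exact Or.inl ⟨n - 2 - p, by omega, by omega⟩)
    rw [← this]
    simp [mul_assoc]
  · intro L hL
    rw [r12, range_eq_cons_cons (by omega)]
    -- the truncated subtraction only serves to keep the entries below `n`: it vanishes for `k < n - 2`
    set L' : List (Fin n) :=
      ⟨0, by omega⟩ :: (List.range (n - 2)).map fun k => ⟨k + 1 - (k + 2 - n), by omega⟩ with hL'
    have hdesc : (L'.map e).prod = s * (t *
        ((List.range (n - 2)).map ((π ∘ fun k => xw n (n - k)) ∘ (· + 2))).prod) := by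
      rw [hL', List.map_cons, List.prod_cons, e_first _ rfl, mul_assoc, List.map_map]
      congr 3
      refine List.map_congr_left fun k hk => ?_
      rw [List.mem_range] at hk
      exact e_inner (n - (k + 2)) _ (by omega) (by omega) (by simp only; omega)
    rw [List.map_cons, List.map_cons, List.prod_cons, List.prod_cons, List.map_map]
    refine Eq.trans hdesc.symm (prod_map_congr commute idem fun p => ?_)
    rw [hL]
    simp only [hL', List.mem_map, List.mem_range, List.mem_cons, Fin.ext_iff]
    constructor
    · rintro (h0 | ⟨k, hk, hkp⟩) <;> omega
    · intro hp
      by_cases p0 : (p : ℕ) = 0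
      · exact Or.inl p0
      · exact Or.inr ⟨p - 1, by omega, by omega⟩

end Presentation

/-! ### The defining relations hold for partial isometries -/

section Soundness

open DP

variable {n : ℕ}

theorem lift_xw_self (hn : 3 ≤ n) : FreeMonoid.lift (generator n) (xw n n) = down n := by
  rw [xw, dif_pos ⟨by omega, le_rfl⟩, FreeMonoid.lift_eval_of, generator, if_pos rfl]
  rfl

theorem lift_xw_pred (hn : 3 ≤ n) : FreeMonoid.lift (generator n) (xw n (n - 1)) = up n := by
  rw [xw, dif_pos ⟨by omega, by omega⟩, FreeMonoid.lift_eval_of, generator, if_neg (by omega),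
    if_pos rfl]
  rfl

theorem lift_xw_inner {i : ℕ} (hi : 1 ≤ i) (hin : i ≤ n - 2) :
    FreeMonoid.lift (generator n) (xw n i) = omitting n (n - i) := by
  rw [xw, dif_pos ⟨hi, by omega⟩, FreeMonoid.lift_eval_of, generator, if_neg (by omega),
    if_neg (by omega)]
  rfl

theorem lift_hw : FreeMonoid.lift (generator n) (hw n) = rev n := by
  rw [hw, FreeMonoid.lift_eval_of]
  rfl

theorem maps_mul_prod_omitting (L : List ℕ) (α : DP n) (i k : Fin n) :
    maps (α * (L.map (omitting n)).prod) i k ↔ maps α i k ∧ (k : ℕ) + 1 ∉ L := by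
  rw [maps_mul]
  constructor
  · rintro ⟨j, hj, hjk⟩
    rw [maps_prod_omitting, ← Fin.ext_iff] at hjk
    obtain ⟨rfl, h⟩ := hjk
    exact ⟨hj, h⟩
  · rintro ⟨h, hk⟩
    exact ⟨k, h, (maps_prod_omitting _ _ _).2 ⟨rfl, hk⟩⟩

theorem lift_ascWord : FreeMonoid.lift (generator n) (ascWord n (n - 2)) =
    (((List.range (n - 2)).map fun k => n - (k + 1)).map (omitting n)).prod := by
  rw [ascWord, map_list_prod, List.map_map, List.map_map]
  congr 1
  refine List.map_congr_left fun k hk => ?_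
  rw [List.mem_range] at hk
  exact lift_xw_inner (by omega) (by omega)

theorem lift_descWord (hn : 3 ≤ n) : FreeMonoid.lift (generator n) (descWord n n) =
    down n * up n * (((List.range (n - 2)).map fun k => n - (n - (k + 2))).map (omitting n)).prod := by
  rw [descWord, range_eq_cons_cons (by omega), List.map_cons, List.map_cons, List.prod_cons,
    List.prod_cons, map_mul, map_mul, Nat.sub_zero, lift_xw_self hn, lift_xw_pred hn, map_list_prod,
    List.map_map, List.map_map, List.map_map, mul_assoc]
  congr 3
  refine List.map_congr_left fun k hk => ?_
  rw [List.mem_range] at hk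
  exact lift_xw_inner (i := n - (k + 2)) (by omega) (by omega)

theorem lift_generator_eq_of_mem_relationsU (hn : 3 ≤ n) (u v : FreeMonoid (Letter n))
    (huv : (u, v) ∈ relationsU n) :
    FreeMonoid.lift (generator n) u = FreeMonoid.lift (generator n) v := by
  rcases huv with ((((⟨i, h1, h2, h⟩ | ⟨i, j, h1, h2, h3, h⟩) | ⟨i, h1, h2, h⟩) | h) |
    ⟨i, h1, h2, h⟩) | h
  · obtain ⟨rfl, rfl⟩ := Prod.ext_iff.1 h
    refine ext_maps fun a b => ?_
    simp only [pow_two, map_mul]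
    rw [lift_xw_inner h1 (by omega), maps_mul_omitting, maps_omitting]
    omega
  · obtain ⟨rfl, rfl⟩ := Prod.ext_iff.1 h
    refine ext_maps fun a b => ?_
    simp only [map_mul]
    rw [lift_xw_inner h1 (by omega), lift_xw_inner (by omega) h3, maps_mul_omitting, maps_omitting,
      maps_mul_omitting, maps_omitting]
    omega
  · obtain ⟨rfl, rfl⟩ := Prod.ext_iff.1 h
    refine ext_maps fun a b => ?_
    simp only [map_mul]
    rw [lift_xw_self hn, lift_xw_inner h1 (by omega),
      lift_xw_inner (i := i + 1) (by omega) (by omega),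
      maps_mul_omitting, maps_down, maps_mul_down]
    simp only [maps_omitting, exists_prop]
    omega
  · simp only [Set.mem_insert_iff, Set.mem_singleton_iff] at h
    rcases h with h | h | h | h | h | h | h <;> obtain ⟨rfl, rfl⟩ := Prod.ext_iff.1 h <;>
      refine ext_maps fun a b => ?_
    · simp only [map_mul, map_pow, lift_xw_self hn, lift_hw,
        lift_xw_inner (n := n) (i := 1) le_rfl (by omega), maps_mul_down, maps_mul_rev,
        maps_mul_omitting, maps_rev, maps_down_pow, exists_prop]
      omega
    · simp only [map_mul, lift_xw_self hn, lift_hw, pow_two, ← mul_assoc,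
        lift_xw_inner (n := n) (i := 1) le_rfl (by omega), maps_mul_down, maps_mul_rev,
        maps_mul_omitting, maps_rev, maps_down, exists_prop]
      omega
    · simp only [map_mul, lift_xw_self hn, lift_hw, maps_mul_down, maps_mul_rev,
        maps_down, exists_prop]
      omega
    · simp only [map_mul, map_pow, lift_xw_self hn, lift_xw_pred hn, lift_ascWord,
        lift_xw_inner (n := n) (i := n - 2) (by omega) le_rfl, maps_down_pow, maps_mul_omitting,
        maps_mul_up, maps_prod_omitting, List.mem_map, List.mem_range, not_exists, not_and]
      refine iff_of_false (by omega) ?_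
      rintro ⟨⟨h1, h2, h3⟩, h4⟩
      have := h3 (n - 2 - a)
      omega
    · simp only [map_pow, lift_xw_self hn, maps_down_pow]
      omega
    · simp only [pow_two, map_mul, map_one, lift_hw, maps_mul_rev, maps_rev, maps_one]
      omega
    · simp only [map_mul, lift_xw_self hn, lift_xw_pred hn, lift_hw, maps_mul_rev, maps_mul_down,
        maps_rev, maps_up, exists_prop]
      omega
  · obtain ⟨rfl, rfl⟩ := Prod.ext_iff.1 h
    refine ext_maps fun a b => ?_
    simp only [map_mul, lift_hw]
    rw [lift_xw_inner h1 (by omega), lift_xw_inner (by omega) (by omega), maps_mul_omitting, maps_rev,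
      maps_mul_rev, maps_omitting]
    simp only
    omega
  · obtain ⟨rfl, rfl⟩ := Prod.ext_iff.1 (Set.mem_singleton_iff.1 h)
    refine ext_maps fun a b => ?_
    simp only [map_mul, map_pow, lift_xw_self hn, lift_hw, lift_descWord hn, maps_mul_rev,
      maps_down_pow, maps_mul_prod_omitting, maps_mul_up, maps_down, List.mem_map, List.mem_range,
      not_exists, not_and]
    constructor
    · intro hab
      refine ⟨by omega, fun k hk => by omega⟩
    · rintro ⟨⟨hb, hab⟩, hk⟩
      have := hk (b - 1)
      omega

end Soundness

/-! ### The number of relations -/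

/-- The sum over the letters of a word of a weight `f`, where `x i` has weight `f i` and `h` has
weight `f 0`. -/
def wordWeight (n : ℕ) (f : ℕ → ℕ) (u : FreeMonoid (Letter n)) : ℕ :=
  Multiplicative.toAdd (FreeMonoid.lift (fun a : Letter n => match a with
    | .x i _ => Multiplicative.ofAdd (f i)
    | .h => Multiplicative.ofAdd (f 0)) u)

section Count

variable {n : ℕ} (f : ℕ → ℕ)

theorem wordWeight_mul (u v : FreeMonoid (Letter n)) :
    wordWeight n f (u * v) = wordWeight n f u + wordWeight n f v := by
  simp [wordWeight]

theorem wordWeight_pow (u : FreeMonoid (Letter n)) (k : ℕ) :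
    wordWeight n f (u ^ k) = k * wordWeight n f u := by
  simp [wordWeight]

theorem wordWeight_hw : wordWeight n f (hw n) = f 0 := by
  simp [wordWeight, hw]

theorem wordWeight_xw {i : ℕ} (hi : 1 ≤ i) (hin : i ≤ n) : wordWeight n f (xw n i) = f i := by
  simp [wordWeight, xw, hi, hin]

theorem eq_of_xw_eq_xw {i j : ℕ} (hi : 1 ≤ i) (hin : i ≤ n) (hj : 1 ≤ j) (hjn : j ≤ n)
    (hij : xw n i = xw n j) : i = j := by
  have := congrArg (wordWeight n id) hij
  rwa [wordWeight_xw _ hi hin, wordWeight_xw _ hj hjn] at this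

theorem finite_and_ncard_family {α : Type*} (g : ℕ → α) (m : ℕ)
    (hg : ∀ i j, 1 ≤ i → i ≤ m → 1 ≤ j → j ≤ m → g i = g j → i = j) :
    {r | ∃ i, 1 ≤ i ∧ i ≤ m ∧ r = g i}.Finite ∧
      {r | ∃ i, 1 ≤ i ∧ i ≤ m ∧ r = g i}.ncard = m := by
  classical
  have hset : {r | ∃ i, 1 ≤ i ∧ i ≤ m ∧ r = g i} = ((Finset.Icc 1 m).image g : Set α) := by
    ext r
    simp only [Set.mem_ofPred_eq, Finset.coe_image, Finset.coe_Icc, Set.mem_image, Set.mem_Icc]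
    grind
  rw [hset]
  refine ⟨Finset.finite_toSet _, ?_⟩
  rw [Set.ncard_coe_finset, Finset.card_image_of_injOn]
  · simp
  · intro i hi j hj hij
    simp only [Finset.coe_Icc, Set.mem_Icc] at hi hj
    exact hg i j hi.1 hi.2 hj.1 hj.2 hij

theorem finite_and_ncard_pairs {α : Type*} (g : ℕ → ℕ → α) (m : ℕ)
    (hg : ∀ i j i' j', 1 ≤ i → i < j → j ≤ m → 1 ≤ i' → i' < j' → j' ≤ m →
      g i j = g i' j' → i = i' ∧ j = j') :
    {r | ∃ i j, 1 ≤ i ∧ i < j ∧ j ≤ m ∧ r = g i j}.Finite ∧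
      {r | ∃ i j, 1 ≤ i ∧ i < j ∧ j ≤ m ∧ r = g i j}.ncard * 2 = m * (m - 1) := by
  classical
  set S : Finset (Σ _ : ℕ, ℕ) := (Finset.range m).sigma fun j => Finset.range j
  have hset : {r | ∃ i j, 1 ≤ i ∧ i < j ∧ j ≤ m ∧ r = g i j} =
      (S.image fun q => g (q.2 + 1) (q.1 + 1) : Set α) := by
    ext r
    simp only [Set.mem_ofPred_eq, Finset.coe_image, Set.mem_image, Finset.mem_coe, S,
      Finset.mem_sigma, Finset.mem_range]
    constructor
    · rintro ⟨i, j, h1, h2, h3, rfl⟩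
      refine ⟨⟨j - 1, i - 1⟩, ⟨by simp only; omega, by simp only; omega⟩, ?_⟩
      simp only
      rw [Nat.sub_add_cancel h1, Nat.sub_add_cancel (by omega)]
    · rintro ⟨⟨j, i⟩, ⟨h1, h2⟩, rfl⟩
      simp only at h1 h2
      exact ⟨i + 1, j + 1, by omega, by omega, by omega, rfl⟩
  rw [hset]
  refine ⟨Finset.finite_toSet _, ?_⟩
  rw [Set.ncard_coe_finset, Finset.card_image_of_injOn]
  · rw [Finset.card_sigma]
    simp only [Finset.card_range]
    exact Finset.sum_range_id_mul_two m
  · rintro ⟨j, i⟩ hq ⟨j', i'⟩ hq' hij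
    simp only [S, Finset.mem_coe, Finset.mem_sigma, Finset.mem_range] at hq hq'
    obtain ⟨h1, h2⟩ := hg (i + 1) (j + 1) (i' + 1) (j' + 1) (by omega) (by omega) (by omega)
      (by omega) (by omega) (by omega) hij
    obtain rfl : i = i' := by omega
    obtain rfl : j = j' := by omega
    rfl

/-- The families making up `relationsU` are told apart by the length, the number of letters `h` and
the number of letters `x n` of the left-hand side, and the length of the right-hand side. -/
theorem finite_and_ncard_relationsU (hn : 3 ≤ n) : (relationsU n).Finite ∧
    2 * (relationsU n).ncard = 4 * ((n - 1) / 2) + (n - 2) * (n - 3) + 2 * n + 10 := by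
  -- the statistics of a relation; the indices of the families below follow the order in which
  -- `relationsU` lists them
  set W := FreeMonoid (Letter n) × FreeMonoid (Letter n)
  set a : W → ℕ := fun r => wordWeight n (fun _ => 1) r.1 with ha
  set b : W → ℕ := fun r => wordWeight n (fun i => if i = 0 then 1 else 0) r.1 with hb
  set c : W → ℕ := fun r => wordWeight n (fun i => if i = n then 1 else 0) r.1 with hc
  set d : W → ℕ := fun r => wordWeight n (fun _ => 1) r.2 with hd
  have n0 : n ≠ 0 := by omega
  have n0' : 0 ≠ n := by omega
  have n1 : 1 ≤ n := by omega
  have hx := fun (f : ℕ → ℕ) => wordWeight_xw (n := n) f n1 le_rfl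
  have hx1 := fun (f : ℕ → ℕ) => wordWeight_xw (n := n) f le_rfl n1
  set F1 : Set W := {r | ∃ i, 1 ≤ i ∧ i ≤ (n - 1) / 2 ∧ r = (xw n i ^ 2, xw n i)} with hF1
  set F2 : Set W := {r | ∃ i j, 1 ≤ i ∧ i < j ∧ j ≤ n - 2 ∧
    r = (xw n i * xw n j, xw n j * xw n i)} with hF2
  set F3 : Set W := {r | ∃ i, 1 ≤ i ∧ i ≤ n - 3 ∧
    r = (xw n n * xw n (i + 1), xw n i * xw n n)} with hF3
  set r4 : W := (xw n n ^ 2 * hw n * xw n n * hw n, hw n * xw n 1 * hw n * xw n n) with hr4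
  set r5 : W := (hw n * xw n n * hw n * xw n n ^ 2, xw n n * xw n 1) with hr5
  set r6 : W := (xw n n * hw n * xw n n * hw n * xw n n, xw n n) with hr6
  set r7 : W := (xw n n ^ n, ascWord n (n - 2) * xw n (n - 1) * xw n (n - 2)) with hr7
  set r8 : W := (xw n n ^ (n + 1), xw n n ^ n) with hr8
  set r9 : W := (hw n ^ 2, 1) with hr9
  set r10 : W := (hw n * xw n n, xw n (n - 1) * hw n) with hr10
  set F11 : Set W := {r | ∃ i, 1 ≤ i ∧ i ≤ (n - 1) / 2 ∧
    r = (hw n * xw n i, xw n (n - i - 1) * hw n)} with hF11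
  set r12 : W := (xw n n ^ (n - 1) * hw n, descWord n n) with hr12
  have hU : relationsU n =
      ((((F1 ∪ F2) ∪ F3) ∪ {r4, r5, r6, r7, r8, r9, r10}) ∪ F11) ∪ {r12} := rfl
  have k1 : ∀ r ∈ F1, a r = 2 ∧ b r = 0 ∧ c r = 0 ∧ d r = 1 := by
    rintro r ⟨i, h1, h2, rfl⟩
    have hxi := fun (f : ℕ → ℕ) => wordWeight_xw (n := n) f h1 (by omega)
    have : i ≠ 0 := by omega
    have : i ≠ n := by omega
    simp [wordWeight_pow, *]
  have k2 : ∀ r ∈ F2, a r = 2 ∧ b r = 0 ∧ c r = 0 ∧ d r = 2 := by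
    rintro r ⟨i, j, h1, h2, h3, rfl⟩
    have hxi := fun (f : ℕ → ℕ) => wordWeight_xw (n := n) f h1 (by omega)
    have hxj := fun (f : ℕ → ℕ) => wordWeight_xw (n := n) (i := j) f (by omega) (by omega)
    have : i ≠ 0 := by omega
    have : i ≠ n := by omega
    have : j ≠ 0 := by omega
    have : j ≠ n := by omega
    simp [wordWeight_mul, *]
  have k3 : ∀ r ∈ F3, a r = 2 ∧ b r = 0 ∧ c r = 1 := by
    rintro r ⟨i, h1, h2, rfl⟩
    have hxi := fun (f : ℕ → ℕ) => wordWeight_xw (n := n) (i := i + 1) f (by omega) (by omega)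
    have : i + 1 ≠ n := by omega
    simp [wordWeight_mul, *]
  have k11 : ∀ r ∈ F11, a r = 2 ∧ b r = 1 ∧ c r = 0 := by
    rintro r ⟨i, h1, h2, rfl⟩
    have hxi := fun (f : ℕ → ℕ) => wordWeight_xw (n := n) f h1 (by omega)
    have : i ≠ 0 := by omega
    have : i ≠ n := by omega
    simp [wordWeight_mul, wordWeight_hw, *]
  have k4 : a r4 = 5 ∧ b r4 = 2 ∧ c r4 = 3 ∧ d r4 = 4 := by
    simp [ha, hb, hc, hd, hr4, wordWeight_mul, wordWeight_pow, wordWeight_hw, hx, hx1, n0, n0']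
  have k5 : a r5 = 5 ∧ b r5 = 2 ∧ c r5 = 3 ∧ d r5 = 2 := by
    simp [ha, hb, hc, hd, hr5, wordWeight_mul, wordWeight_pow, wordWeight_hw, hx, hx1, n0, n0']
  have k6 : a r6 = 5 ∧ b r6 = 2 ∧ c r6 = 3 ∧ d r6 = 1 := by
    simp [ha, hb, hc, hd, hr6, wordWeight_mul, wordWeight_hw, hx, n0, n0']
  have k7 : a r7 = n ∧ b r7 = 0 ∧ c r7 = n := by
    simp [ha, hb, hc, hr7, wordWeight_pow, hx, n0]
  have k8 : a r8 = n + 1 ∧ b r8 = 0 ∧ c r8 = n + 1 := by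
    simp [ha, hb, hc, hr8, wordWeight_pow, hx, n0]
  have k9 : a r9 = 2 ∧ b r9 = 2 ∧ c r9 = 0 := by
    simp [ha, hb, hc, hr9, wordWeight_pow, wordWeight_hw, n0']
  have k10 : a r10 = 2 ∧ b r10 = 1 ∧ c r10 = 1 := by
    simp [ha, hb, hc, hr10, wordWeight_mul, wordWeight_hw, hx, n0, n0']
  have k12 : a r12 = n ∧ b r12 = 1 ∧ c r12 = n - 1 := by
    simp [ha, hb, hc, hr12, wordWeight_mul, wordWeight_pow, wordWeight_hw, hx, n0, n0']
    omega
  obtain ⟨f1, c1⟩ : F1.Finite ∧ F1.ncard = (n - 1) / 2 :=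
    finite_and_ncard_family _ _ fun i j h1 h2 h3 h4 hij =>
      eq_of_xw_eq_xw h1 (by omega) h3 (by omega) (Prod.ext_iff.1 hij).2
  obtain ⟨f2, c2⟩ : F2.Finite ∧ F2.ncard * 2 = (n - 2) * (n - 2 - 1) := by
    refine finite_and_ncard_pairs (fun i j => (xw n i * xw n j, xw n j * xw n i)) _ ?_
    intro i j i' j' h1 h2 h3 h4 h5 h6 hij
    have h7 := (Prod.ext_iff.1 hij).1
    simp only [xw] at h7
    rw [dif_pos ⟨by omega, by omega⟩, dif_pos ⟨by omega, by omega⟩, dif_pos ⟨by omega, by omega⟩,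
      dif_pos ⟨by omega, by omega⟩] at h7
    have h8 := congrArg FreeMonoid.toList h7
    simpa using h8
  obtain ⟨f3, c3⟩ : F3.Finite ∧ F3.ncard = n - 3 :=
    finite_and_ncard_family _ _ fun i j h1 h2 h3 h4 hij =>
      eq_of_xw_eq_xw h1 (by omega) h3 (by omega) (mul_right_cancel (Prod.ext_iff.1 hij).2)
  obtain ⟨f11, c11⟩ : F11.Finite ∧ F11.ncard = (n - 1) / 2 :=
    finite_and_ncard_family _ _ fun i j h1 h2 h3 h4 hij =>
      eq_of_xw_eq_xw h1 (by omega) h3 (by omega) (mul_left_cancel (Prod.ext_iff.1 hij).1)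
  have ne : ∀ {r r' : W}, a r ≠ a r' ∨ b r ≠ b r' ∨ c r ≠ c r' ∨ d r ≠ d r' → r ≠ r' := by
    rintro r r' hrr rfl
    omega
  set G : Set W := {r4, r5, r6, r7, r8, r9, r10} with hG
  have fG : G.Finite := Set.toFinite _
  have cG : G.ncard = 7 := by
    rw [hG, Set.ncard_insert_of_notMem, Set.ncard_insert_of_notMem, Set.ncard_insert_of_notMem,
      Set.ncard_insert_of_notMem, Set.ncard_insert_of_notMem, Set.ncard_insert_of_notMem,
      Set.ncard_singleton]
    all_goals
      simp only [Set.mem_insert_iff, Set.mem_singleton_iff, not_or]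
      repeat' apply And.intro
      all_goals exact ne (by omega)
  have kG : ∀ r ∈ G, r = r4 ∨ r = r5 ∨ r = r6 ∨ r = r7 ∨ r = r8 ∨ r = r9 ∨ r = r10 :=
    fun r hr => hr
  have d2 : Disjoint F1 F2 := Set.disjoint_left.2 fun r h1 h2 => by
    have := k1 r h1
    have := k2 r h2
    omega
  have d3 : Disjoint (F1 ∪ F2) F3 := Set.disjoint_left.2 fun r h1 h2 => by
    have := k3 r h2
    rcases h1 with h1 | h1
    · have := k1 r h1
      omega
    · have := k2 r h1
      omega
  have dG : Disjoint ((F1 ∪ F2) ∪ F3) G := Set.disjoint_left.2 fun r h1 h2 => by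
    have hr : a r = 2 ∧ b r = 0 ∧ c r ≤ 1 := by
      rcases h1 with (h1 | h1) | h1
      · have := k1 r h1
        omega
      · have := k2 r h1
        omega
      · have := k3 r h1
        omega
    rcases kG r h2 with rfl | rfl | rfl | rfl | rfl | rfl | rfl <;> omega
  have d11 : Disjoint (((F1 ∪ F2) ∪ F3) ∪ G) F11 := Set.disjoint_left.2 fun r h1 h2 => by
    have hr := k11 r h2
    rcases h1 with ((h1 | h1) | h1) | h1
    · have := k1 r h1
      omega
    · have := k2 r h1
      omega
    · have := k3 r h1
      omega
    · rcases kG r h1 with rfl | rfl | rfl | rfl | rfl | rfl | rfl <;> omega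
  have d12 : Disjoint ((((F1 ∪ F2) ∪ F3) ∪ G) ∪ F11) {r12} := Set.disjoint_left.2 fun r h1 h2 => by
    obtain rfl : r = r12 := h2
    rcases h1 with (((h1 | h1) | h1) | h1) | h1
    · have := k1 _ h1
      omega
    · have := k2 _ h1
      omega
    · have := k3 _ h1
      omega
    · rcases kG _ h1 with h | h | h | h | h | h | h <;> revert h <;> exact ne (by omega)
    · have := k11 _ h1
      omega
  have f12 : ({r12} : Set W).Finite := Set.finite_singleton _
  have g3 := (f1.union f2).union f3
  have gG := g3.union fG
  have g11 := gG.union f11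
  rw [hU]
  refine ⟨g11.union f12, ?_⟩
  rw [Set.ncard_union_eq d12 g11 f12, Set.ncard_union_eq d11 gG f11, Set.ncard_union_eq dG g3 fG,
    Set.ncard_union_eq d3 (f1.union f2) f3, Set.ncard_union_eq d2 f1 f2, Set.ncard_singleton, c1,
    c3, c11, cG]
  rw [show n - 2 - 1 = n - 3 by omega] at c2
  rw [← c2]
  omega

theorem ncard_relationsU (hn : 3 ≤ n) :
    ((relationsU n).ncard : ℚ) = 1 / 2 * ((n : ℚ) ^ 2 - n + 13 - (-1) ^ n) := by
  have h := (finite_and_ncard_relationsU hn).2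
  obtain ⟨m, rfl⟩ : ∃ m, n = m + 3 := ⟨n - 3, by omega⟩
  rw [show m + 3 - 2 = m + 1 by omega, show m + 3 - 3 = m by omega,
    show m + 3 - 1 = m + 2 by omega] at h
  rcases Nat.even_or_odd' m with ⟨k, rfl | rfl⟩
  · rw [show (2 * k + 2) / 2 = k + 1 by omega] at h
    have h' : (2 : ℚ) * (relationsU (2 * k + 3)).ncard =
      4 * (k + 1) + (2 * k + 1) * (2 * k) + 2 * (2 * k + 3) + 10 := by exact_mod_cast h
    have hp : (-1 : ℚ) ^ (2 * k + 3) = -1 := Odd.neg_one_pow ⟨k + 1, by ring⟩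
    rw [hp]
    push_cast
    linarith
  · rw [show (2 * k + 1 + 2) / 2 = k + 1 by omega] at h
    have h' : (2 : ℚ) * (relationsU (2 * k + 1 + 3)).ncard =
      4 * (k + 1) + (2 * k + 1 + 1) * (2 * k + 1) + 2 * (2 * k + 1 + 3) + 10 := by exact_mod_cast h
    have hp : (-1 : ℚ) ^ (2 * k + 1 + 3) = 1 := Even.neg_one_pow ⟨k + 2, by ring⟩
    rw [hp]
    push_cast
    linarith

end Count

/-! ### The generators -/

theorem natCard_letter (n : ℕ) : Nat.card (Letter n) = n + 1 := by
  let E : Letter n ≃ Option (Fin n) :=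
    { toFun := fun a => match a with
        | .x i hi => some ⟨i - 1, by omega⟩
        | .h => none
      invFun := fun a => match a with
        | some i => .x (i + 1) (by omega)
        | none => .h
      left_inv := by
        rintro (⟨i, hi⟩ | _)
        · simp only [Letter.x.injEq]
          omega
        · rfl
      right_inv := by
        rintro (_ | i)
        · rfl
        · simp }
  rw [Nat.card_congr E]
  simp

open DP in
theorem generator_x_cases {n : ℕ} (i : ℕ) (hi : 1 ≤ i ∧ i ≤ n) :
    (i = n ∧ generator n (.x i hi) = down n) ∨ (i + 1 = n ∧ generator n (.x i hi) = up n) ∨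
      (i + 2 ≤ n ∧ generator n (.x i hi) = omitting n (n - i)) := by
  by_cases h1 : i = n
  · exact Or.inl ⟨h1, if_pos h1⟩
  by_cases h2 : i = n - 1
  · exact Or.inr (Or.inl ⟨by omega, (if_neg h1).trans (if_pos h2)⟩)
  · exact Or.inr (Or.inr ⟨by omega, (if_neg h1).trans (if_neg h2)⟩)

open DP in
theorem generator_x_ne_h {n : ℕ} (hn : 3 ≤ n) (i : ℕ) (hi : 1 ≤ i ∧ i ≤ n) :
    generator n (.x i hi) ≠ generator n .h := by
  intro huv
  -- the images of the first point under the two maps differ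
  have h1 : maps (generator n (.x i hi)) ⟨0, by omega⟩ ⟨n - 1, by omega⟩ := by
    rw [huv]
    exact (maps_rev _ _).2 (by simp only; omega)
  rcases generator_x_cases i hi with ⟨h, hg⟩ | ⟨h, hg⟩ | ⟨h, hg⟩ <;> rw [hg] at h1
  · have := (maps_down _ _).1 h1
    simp only at this
    omega
  · have := (maps_up _ _).1 h1
    simp only at this
    omega
  · have := (maps_omitting _ _ _).1 h1
    simp only at this
    omega

open DP in
theorem generator_injective {n : ℕ} (hn : 3 ≤ n) : Function.Injective (generator n) := by
  rintro (⟨i, hi⟩ | _) (⟨j, hj⟩ | _) huv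
  · -- the image of the first point and the omitted point are compared
    have key : ∀ (p q : ℕ) (hp : p < n) (hq : q < n),
        maps (generator n (.x i hi)) ⟨p, hp⟩ ⟨q, hq⟩ ↔
          maps (generator n (.x j hj)) ⟨p, hp⟩ ⟨q, hq⟩ := fun p q hp hq => by rw [huv]
    have h1 := key 0 0 (by omega) (by omega)
    have h2 := key 0 1 (by omega) (by omega)
    have h3 := key (n - 1 - i) (n - 1 - i) (by omega) (by omega)
    have : i = j := by
      rcases generator_x_cases i hi with ⟨h, hg⟩ | ⟨h, hg⟩ | ⟨h, hg⟩ <;>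
        rcases generator_x_cases j hj with ⟨h', hg'⟩ | ⟨h', hg'⟩ | ⟨h', hg'⟩ <;>
        rw [hg, hg'] at h1 h2 h3 <;>
        simp only [maps_down, maps_up, maps_omitting, true_and, true_iff, iff_true] at h1 h2 h3 <;>
        omega
    subst this
    rfl
  · exact (generator_x_ne_h hn i hi huv).elim
  · exact (generator_x_ne_h hn j hj huv.symm).elim
  · rfl

theorem mainTheorem2 (n : ℕ) (hn : 3 ≤ n) :
    (∃ e : PresentedMonoid (fun u v : FreeMonoid (Letter n) => (u, v) ∈ relationsU n) ≃* DP n,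
      ∀ a : Letter n, e (PresentedMonoid.of _ a) = generator n a) ∧
    Function.Injective (generator n) ∧
    Nat.card (Letter n) = n + 1 ∧
    (relationsU n).Finite ∧
    ((relationsU n).ncard : ℚ) = 1 / 2 * ((n : ℚ) ^ 2 - n + 13 - (-1) ^ n) := by
  refine ⟨?_, generator_injective hn, natCard_letter n, (finite_and_ncard_relationsU hn).1,
    ncard_relationsU hn⟩
  set rels := fun u v : FreeMonoid (Letter n) => (u, v) ∈ relationsU n with hrels
  let φ : PresentedMonoid rels →* DP n :=
    PresentedMonoid.lift (generator n) (lift_generator_eq_of_mem_relationsU hn)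
  have hφ : ∀ u, φ (PresentedMonoid.mk rels u) = FreeMonoid.lift (generator n) u := fun u => rfl
  have H := isometryRelations_of_relationsU (π := PresentedMonoid.mk rels) hn
    fun u v huv => PresentedMonoid.mk_eq_mk_of_rel huv
  set x : ℕ → PresentedMonoid rels := fun i => PresentedMonoid.mk rels (xw n i) with hx
  have hs : φ (x n) = DP.down n := lift_xw_self hn
  have ht : φ (x (n - 1)) = DP.up n := lift_xw_pred hn
  have hh : φ (PresentedMonoid.mk rels (hw n)) = DP.rev n := lift_hw
  have he : ∀ p : Fin n, φ (pointIdempotent n x p) = DP.omitting n (p + 1) := by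
    intro p
    by_cases h0 : (p : ℕ) = 0
    · rw [pointIdempotent, if_pos h0, map_mul, hs, ht]
      refine DP.ext_maps fun i j => ?_
      simp only [DP.maps_mul_up, DP.maps_down, DP.maps_omitting]
      omega
    by_cases h1 : (p : ℕ) + 1 = n
    · rw [pointIdempotent, if_neg h0, if_pos h1, map_mul, hs, ht]
      refine DP.ext_maps fun i j => ?_
      simp only [DP.maps_mul_down, DP.maps_up, DP.maps_omitting, exists_prop]
      omega
    · rw [pointIdempotent_inner x (n - 1 - p) p (by omega) (by omega) (by omega), hx]
      refine (lift_xw_inner (by omega) (by omega)).trans ?_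
      congr 1
      omega
  have hgen : Submonoid.closure (Set.range (pointIdempotent n x) ∪
      {x n, x (n - 1), PresentedMonoid.mk rels (hw n)}) = ⊤ := by
    rw [eq_top_iff, ← PresentedMonoid.closure_range_of rels]
    refine Submonoid.closure_mono ?_
    rintro _ ⟨⟨i, hi⟩ | _, rfl⟩
    · have hxi : PresentedMonoid.of rels (.x i hi) = x i := by
        rw [hx]
        simp only [xw, dif_pos hi]
        rfl
      rw [hxi]
      by_cases h1 : i = n
      · right; left; rw [h1]
      by_cases h2 : i = n - 1
      · right; right; left; rw [h2]
      · exact Or.inl ⟨⟨n - 1 - i, by omega⟩, pointIdempotent_inner x i _ hi.1 (by omega)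
          (by simp only; omega)⟩
    · right; right; right; rfl
  exact ⟨MulEquiv.ofBijective φ ⟨H.injective_of_generate (by omega) hs ht hh he hgen,
    IsometryRelations.surjective_of_map_eq hs ht hh he⟩, fun a => rfl⟩
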